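/- Let $q$ be a power of a prime $p$, let $d\ge 2$ be an integer, and let $r,u$ be positive integers with $r\le q-1$ and $r>2(d-2)+u$. Put $n=u(r+1)$ and $\kappa=ur-2(d-2)-u$. *Conventions.* An $[n,k,d]_q$ code is a $k$-dimensional subspace $C\subseteq\mathbb F_q^n$ whose nonzero words have minimum Hamming weight $d$; $C^\perp$ is its Euclidean dual. $C$ has locality $r$ if every coordinate lies in the support of a word of $C^\perp$ of weight at most $r+1$. On $(\mathbb C^q)^{\otimes n}$, with standard basis $|z\rangle$, $z\in\mathbb F_q^n$, let $X(a)|z\rangle=|z+a\rangle$ and $Z(b)|z\rangle=\xi_p^{\mathrm{tr}\langle b,z\rangle}|z\rangle$ with $\xi_p=e^{2\pi i/p}$ and $\mathrm{tr}:\mathbb F_q\to\mathbb F_p$ the trace. The support of an error operator $\xi_p^kX(a)Z(b)$ is $\{i: a_i\ne0\text{ or }b_i\neq 0\}$ and its weight is the size of the support. A subspace $\mathcal Q$ with orthogonal projection $P$ detects $E$ if $PEP=\lambda P$ for some $\lambda\in\mathbb C$. $\mathcal Q$ is an $[[n,\kappa,\delta]]_q$ code if $\dim\mathcal Q=q^\kappa$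 and $\delta$ is the least weight of an undetected error operator; it is pure if $PEP=0$ for every error operator $E$ of weight between $1$ and $\delta-1$. $\mathcal Q$ has locality $r$ if it is the space of vectors fixed by an abelian group $G$ of error operators such that for every position $i$ there are $X(a)Z(b),X(x)Z(y)\in G$ whose supports have a union of size at most $r+1$, with $(a_i,b_i)=(1,0)$ and $(x_i,y_i)=(0,1)$. For $C_1^\perp\subseteq C_2$, the CSS code of $C_1,C_2$ is the space fixed by all $X(a)$, $a\in C_1^\perp$, and all $Z(b)$, $b\in C_2^\perp$. $GRS_k(a,v)$ is the span of the vectors $(v_ja_j^{l})_j$, $0\le l<k$. **Theorem.** 1. There is a pure $[[u(r+1),\,ur-2(d-2)-u,\,d]]_q$ quantum code with locality $r$. With $\delta=d$, its parameters satisfy with equality $$2\delta\le n-\kappa-2\left\lceil\frac{\kappa}{r}\right\rceil+4$$ and $$\kappa\le n-2(\delta-1)-\left\lfloor\frac{n-(\delta-1)}{r+1}\right\rfloor-\left\lfloor\frac{n-2(\delta-1)-\left\lfloor\frac{n-(\delta-1)}{r+1}\right\rfloor}{r+1}\right\rfloor .$$ 2. Let $a_1,\dots,a_u\in\mathbb F_q^{r+1}$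 each have $r+1$ distinct coordinates, forming the sets $T_{a_1},\dots,T_{a_u}$, and let $v_1,\dots,v_u\in(\mathbb F_q^*)^{r+1}$. If $d\ge5$, assume also that $\bigl|\bigcup_{g\in S}T_{a_g}\bigr|\ge r|S|+1$ for every nonempty $S\subseteq\{1,\dots,u\}$ with $|S|\le\lfloor (d-1)/2\rfloor$. Then there are $v_1',\dots,v_u'\in(\mathbb F_q^*)^{r+1}$ with $GRS_{d-1}(a_i,v_i)^\perp=GRS_{r-d+2}(a_i,v_i')$ for all $i$ such that the following holds. Let $C_1$ and $C_2$ be the codes with parity-check matrices $$\begin{pmatrix}v_1&&\\&\ddots&\\&&v_u\\G_1&\cdots&G_u\end{pmatrix},\qquad\begin{pmatrix}v_1'&&\\&\ddots&\\&&v_u'\\G_1'&\cdots&G_u'\end{pmatrix},$$ where $G_i$ has the $d-2$ rows $(v_{ij}a_{ij}^{l})_j$, $1\le l\le d-2$, and $G_i'$ likewise with $v_i'$ in place of $v_i$. Then $C_1$ and $C_2$ are $[u(r+1),ur-d+2,d]_q$ codes with locality $r$ that attain $d\le n-k-\lceil k/r\rceil+2$ (where $k=ur-d+2$) with equality, $C_1^\perp\subsetneq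 C_2$, and their CSS code is a pure $[[u(r+1),ur-2(d-2)-u,d]]_q$ code with locality $r$. -/

import Mathlib

open scoped BigOperators

noncomputable section

/-! ### Classical linear codes over a finite field -/

/-- The Euclidean dual code. -/
def dualCode {ι F : Type*} [Fintype ι] [Field F] (C : Submodule F (ι → F)) :
    Submodule F (ι → F) where
  carrier := {a | ∀ c ∈ C, ∑ i, a i * c i = 0}
  zero_mem' := by intro c _; simp
  add_mem' := by
    intro a b ha hb c hc
    simp only [Pi.add_apply, add_mul, Finset.sum_add_distrib]
    rw [ha c hc, hb c hc, add_zero]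
  smul_mem' := by
    intro t a ha c hc
    simp only [Pi.smul_apply, smul_eq_mul, mul_assoc, ← Finset.mul_sum]
    rw [ha c hc, mul_zero]

/-- `C` is an `[n, k, d]` linear code, where `n` is the number of coordinates: it has dimension
`k`, and the least Hamming weight of a nonzero codeword is `d`. -/
def IsLinearCode {ι F : Type*} [Fintype ι] [Field F] [DecidableEq F]
    (C : Submodule F (ι → F)) (k d : ℕ) : Prop :=
  Module.finrank F C = k ∧ IsLeast {w : ℕ | ∃ c ∈ C, c ≠ 0 ∧ hammingNorm c = w} d

/-- Locality `r` of a linear code: every coordinate lies in the support of a dual codeword of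
weight at most `r + 1`. -/
def HasLocality {ι F : Type*} [Fintype ι] [Field F] [DecidableEq F]
    (C : Submodule F (ι → F)) (r : ℕ) : Prop :=
  ∀ i, ∃ c ∈ dualCode C, hammingNorm c ≤ r + 1 ∧ c i ≠ 0

/-- Equality in the Singleton-like bound `d ≤ n - k - ⌈k / r⌉ + 2` for classical codes with
locality `r`. -/
def MeetsSingletonLRC (n k d r : ℤ) : Prop :=
  d = n - k - ⌈(k : ℚ) / r⌉ + 2

/-- The generalized Reed-Solomon code `GRS_k(a, v)`: the row space of the `k × n` matrix with
entries `v_j a_j ^ l`, `0 ≤ l < k`. -/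
def grsCode {F : Type*} [Field F] {n : ℕ} (k : ℕ) (a v : Fin n → F) : Submodule F (Fin n → F) :=
  Submodule.span F (Set.range fun (l : Fin k) (j : Fin n) => v j * a j ^ (l : ℕ))

/-- The block parity-check matrix
```
v_1   0   ...  0
 0   v_2  ...  0
 :    :        :
 0    0   ... v_u
G_1  G_2  ... G_u
```
with `u` blocks of `m` columns, where `v_i` on top of `G_i` is the generator matrix of
`GRS_{d-1}(a_i, v_i)` (so `G_i` has the `d - 2` rows `v_{ij} a_{ij} ^ l`, `1 ≤ l ≤ d - 2`). -/
def blockParityCheck {F : Type*} [Field F] {u m : ℕ} (d : ℕ) (a v : Fin u → Fin m → F) :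
    Matrix (Fin u ⊕ Fin (d - 2)) (Fin u × Fin m) F :=
  Matrix.of fun s x =>
    match s with
    | Sum.inl i => if x.1 = i then v x.1 x.2 else 0
    | Sum.inr l => v x.1 x.2 * a x.1 x.2 ^ ((l : ℕ) + 1)

/-- The linear code of length `u * m` with parity-check matrix `blockParityCheck d a v`. -/
def blockCode {F : Type*} [Field F] {u m : ℕ} (d : ℕ) (a v : Fin u → Fin m → F) :
    Submodule F (Fin u × Fin m → F) :=
  LinearMap.ker (blockParityCheck d a v).mulVecLin

/-! ### Quantum codes

`F` is a field with `q = p ^ m` elements, and the qudits are indexed by the finite type `ι`. -/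

/-- The Hilbert space `(ℂ^q)^{⊗n}`, `n = |ι|`, through its standard orthonormal basis `|z⟩`,
`z ∈ F^n`; the basis vector `|z⟩` is `EuclideanSpace.single z 1`. -/
abbrev QuditSpace (ι F : Type*) [Fintype ι] [DecidableEq ι] [Fintype F] : Type _ :=
  EuclideanSpace ℂ (ι → F)

/-- The error operator `X(a) : |z⟩ ↦ |z + a⟩`. -/
def errorX {ι F : Type*} [Fintype ι] [DecidableEq ι] [Field F] [Fintype F] (a : ι → F) :
    QuditSpace ι F ≃ₗ[ℂ] QuditSpace ι F where
  toFun φ := WithLp.toLp 2 fun z => φ (z - a)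
  map_add' _ _ := by ext; simp
  map_smul' _ _ := by ext; simp
  invFun φ := WithLp.toLp 2 fun z => φ (z + a)
  left_inv _ := by ext; simp
  right_inv _ := by ext; simp

/-- `ξ_p ^ tr(x)`, where `ξ_p = exp(2πi/p)` and `tr` is the trace from `F` to `𝔽_p`. -/
def traceChar (p : ℕ) [Fact p.Prime] {F : Type*} [Field F] [Algebra (ZMod p) F] (x : F) : ℂ :=
  ZMod.stdAddChar (Algebra.trace (ZMod p) F x)

theorem traceChar_neg_mul (p : ℕ) [Fact p.Prime] {F : Type*} [Field F] [Algebra (ZMod p) F]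
    (x : F) : traceChar p (-x) * traceChar p x = 1 := by
  simp [traceChar, ← AddChar.map_add_eq_mul]

/-- The error operator `Z(b) : |z⟩ ↦ ξ_p ^ tr(⟨b, z⟩) |z⟩`. -/
def errorZ (p : ℕ) [Fact p.Prime] {ι F : Type*} [Fintype ι] [DecidableEq ι] [Field F] [Fintype F]
    [Algebra (ZMod p) F] (b : ι → F) : QuditSpace ι F ≃ₗ[ℂ] QuditSpace ι F where
  toFun φ := WithLp.toLp 2 fun z => traceChar p (∑ i, b i * z i) * φ z
  map_add' _ _ := by ext; simp [mul_add]
  map_smul' _ _ := by ext; simp [mul_left_comm]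
  invFun φ := WithLp.toLp 2 fun z => traceChar p (-∑ i, b i * z i) * φ z
  left_inv φ := by ext z; simp [← mul_assoc, traceChar_neg_mul]
  right_inv φ := by
    ext z
    have h := traceChar_neg_mul p (∑ i, b i * z i)
    simp only
    linear_combination φ z * h

theorem errorX_single {ι F : Type*} [Fintype ι] [DecidableEq ι] [Field F] [Fintype F]
    [DecidableEq F] (a z : ι → F) :
    errorX a (EuclideanSpace.single z (1 : ℂ)) = EuclideanSpace.single (z + a) (1 : ℂ) := by
  ext y
  simp [errorX, sub_eq_iff_eq_add]

theorem errorZ_single (p : ℕ) [Fact p.Prime] {ι F : Type*} [Fintype ι] [DecidableEq ι] [Field F]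
    [Fintype F] [DecidableEq F] [Algebra (ZMod p) F] (b z : ι → F) :
    errorZ p b (EuclideanSpace.single z (1 : ℂ)) =
      traceChar p (∑ i, b i * z i) • EuclideanSpace.single z (1 : ℂ) := by
  ext y
  by_cases h : y = z
  · subst h
    simp [errorZ]
  · simp [errorZ, h]

/-- The quantum error operators `ξ_p ^ k X(a) Z(b)`. -/
def errorOperators (p : ℕ) [Fact p.Prime] (ι F : Type*) [Fintype ι] [DecidableEq ι] [Field F]
    [Fintype F] [Algebra (ZMod p) F] : Set (QuditSpace ι F ≃ₗ[ℂ] QuditSpace ι F) :=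
  {E | ∃ (k : ZMod p) (a b : ι → F), ∀ φ, E φ = ZMod.stdAddChar k • (errorX a * errorZ p b) φ}

/-- The support of the error operators `ξ_p ^ k X(a) Z(b)`. -/
def errorSupport {ι F : Type*} [Fintype ι] [Field F] [DecidableEq F] (a b : ι → F) : Finset ι :=
  Finset.univ.filter fun i => a i ≠ 0 ∨ b i ≠ 0

/-- The space of vectors fixed by all operators in the group `G`. -/
def stabilizerCode {ι F : Type*} [Fintype ι] [DecidableEq ι] [Fintype F]
    (G : Subgroup (QuditSpace ι F ≃ₗ[ℂ] QuditSpace ι F)) : Submodule ℂ (QuditSpace ι F) where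
  carrier := {φ | ∀ E ∈ G, E φ = φ}
  zero_mem' := by intro E _; simp
  add_mem' := by intro φ ψ hφ hψ E hE; rw [map_add, hφ E hE, hψ E hE]
  smul_mem' := by intro t φ hφ E hE; rw [map_smul, hφ E hE]

/-- The code `Q` detects the error operator `E` (Knill-Laflamme condition `P E P = t P`, with `P`
the orthogonal projection onto `Q`). -/
def Detects {ι F : Type*} [Fintype ι] [DecidableEq ι] [Fintype F]
    (Q : Submodule ℂ (QuditSpace ι F)) (E : QuditSpace ι F ≃ₗ[ℂ] QuditSpace ι F) : Prop :=
  ∃ t : ℂ, ∀ φ ∈ Q, ∀ ψ ∈ Q, inner ℂ φ (E ψ) = t * inner ℂ φ ψ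

/-- `Q` is an `[[n, κ, δ]]_q` quantum code, where `n = |ι|` and `q = |F|`: it has dimension
`q ^ κ`, and the least weight of an undetected error operator is `δ` (so all error operators on at
most `⌊(δ - 1) / 2⌋` positions can be corrected). -/
def IsQuantumCode (p : ℕ) [Fact p.Prime] {ι F : Type*} [Fintype ι] [DecidableEq ι] [Field F]
    [Fintype F] [DecidableEq F] [Algebra (ZMod p) F] (Q : Submodule ℂ (QuditSpace ι F))
    (κ δ : ℕ) : Prop :=
  Module.finrank ℂ Q = Fintype.card F ^ κ ∧
    IsLeast {w : ℕ | ∃ a b : ι → F, (errorSupport a b).card = w ∧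
      ¬ Detects Q (errorX a * errorZ p b)} δ

/-- A quantum code of distance `δ` is pure if every error operator of weight between `1` and
`δ - 1` maps the code to a subspace orthogonal to it. -/
def IsPureCode (p : ℕ) [Fact p.Prime] {ι F : Type*} [Fintype ι] [DecidableEq ι] [Field F]
    [Fintype F] [DecidableEq F] [Algebra (ZMod p) F] (Q : Submodule ℂ (QuditSpace ι F))
    (δ : ℕ) : Prop :=
  ∀ a b : ι → F, 0 < (errorSupport a b).card → (errorSupport a b).card < δ →
    ∀ φ ∈ Q, ∀ ψ ∈ Q, inner ℂ φ ((errorX a * errorZ p b) ψ) = 0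

/-- `Q` is a quantum stabilizer code with locality `r`: `Q = Q(G)` for an abelian group `G` of
error operators such that for every position `i` there are stabilizers `X(a) Z(b)` and `X(x) Z(y)`
in `G` which together act on at most `r + 1` positions (`i` and at most `r` others), with
`(a_i, b_i) = (1, 0)` and `(x_i, y_i) = (0, 1)`. -/
def HasQuantumLocality (p : ℕ) [Fact p.Prime] {ι F : Type*} [Fintype ι] [DecidableEq ι] [Field F]
    [Fintype F] [DecidableEq F] [Algebra (ZMod p) F] (Q : Submodule ℂ (QuditSpace ι F))
    (r : ℕ) : Prop :=
  ∃ G : Subgroup (QuditSpace ι F ≃ₗ[ℂ] QuditSpace ι F),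
    (∀ E ∈ G, E ∈ errorOperators p ι F) ∧ (∀ E ∈ G, ∀ E' ∈ G, E * E' = E' * E) ∧
    Q = stabilizerCode G ∧
    ∀ i : ι, ∃ a b x y : ι → F,
      errorX a * errorZ p b ∈ G ∧ errorX x * errorZ p y ∈ G ∧
      (errorSupport a b ∪ errorSupport x y).card ≤ r + 1 ∧
      a i = 1 ∧ b i = 0 ∧ x i = 0 ∧ y i = 1

/-- The CSS code of two linear codes `C₁`, `C₂` with `C₁^⊥ ⊆ C₂`: the stabilizer code of the group
generated by the `X(a)`, `a ∈ C₁^⊥`, and the `Z(b)`, `b ∈ C₂^⊥`. -/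
def cssCode (p : ℕ) [Fact p.Prime] {ι F : Type*} [Fintype ι] [DecidableEq ι] [Field F]
    [Fintype F] [Algebra (ZMod p) F] (C₁ C₂ : Submodule F (ι → F)) :
    Submodule ℂ (QuditSpace ι F) :=
  stabilizerCode (Subgroup.closure
    ({E | ∃ a ∈ dualCode C₁, E = errorX a} ∪ {E | ∃ b ∈ dualCode C₂, E = errorZ p b}))

/-- Equality in the bound `2 δ ≤ n - κ - 2 ⌈κ / r⌉ + 4`. -/
def MeetsQuantumSingleton (n κ δ r : ℤ) : Prop :=
  2 * δ = n - κ - 2 * ⌈(κ : ℚ) / r⌉ + 4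

/-- Equality in the bound `κ ≤ n - 2(δ-1) - ⌊(n - (δ-1)) / (r+1)⌋ -
⌊(n - 2(δ-1) - ⌊(n - (δ-1)) / (r+1)⌋) / (r+1)⌋`. -/
def MeetsQuantumSingletonDim (n κ δ r : ℤ) : Prop :=
  κ = n - 2 * (δ - 1) - ⌊((n - (δ - 1) : ℤ) : ℚ) / (r + 1)⌋ -
    ⌊((n - 2 * (δ - 1) - ⌊((n - (δ - 1) : ℤ) : ℚ) / (r + 1)⌋ : ℤ) : ℚ) / (r + 1)⌋

end

/-! ### Error operators -/

section ErrorOperators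

variable (p : ℕ) [Fact p.Prime] {ι F : Type*} [Fintype ι] [DecidableEq ι] [Field F] [Fintype F]
  [Algebra (ZMod p) F]

/-! A space `S` of labels (a, b) with ⟨b, a'⟩ = 0 for all pairs gives operators X(a)Z(b) that
multiply without phases. Their average is the projector onto the fixed space, and every X(a)Z(b)
other than the identity has trace 0, so the fixed space has dimension q^(n - dim `S`). An operator
not symplectically orthogonal to `S` maps the code to its orthogonal complement; one that is
orthogonal to `S` but outside it is undetected. Since nonzero stabilizers here weigh more than d,
the distance is the least weight in the symplectic dual, and the code is pure
(`isQuantumCode_isPureCode_labelGroup`).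

The labels come from the row space of the block matrix: on block g, a row combination is a
polynomial of degree at most d - 2 evaluated at the points a_g and scaled by v_g. Two facts carry
the argument.

Orthogonality: the nodal weights of r + 1 points annihilate every polynomial of degree less than r
(`sum_nodalWeight_mul_eval_eq_zero`), and a product of two block polynomials has degree at most 2(d
- 2) < r. Hence v' is chosen with v v' equal to the nodal weights.

Distance: in a word of weight less than d in the kernel, every block met and every evaluation point
met is hit at least twice, which contradicts the near-disjointness of the point sets
(`le_hammingNorm_of_mem_blockCode`).

For prescribed point sets this yields the CSS code. For bare existence, the field may be too small
for u nearly disjoint sets, so the block code is taken over the quadratic extension K, with points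
in distinct cosets of F. The trace form of K/F identifies the symplectic dual of its labels with the
Euclidean dual over K (`exists_equiv_symplectic_iff_mem_dualCode`). -/

theorem traceChar_add {F : Type*} [Field F] [Algebra (ZMod p) F] (x y : F) :
    traceChar p (x + y) = traceChar p x * traceChar p y := by
  simp [traceChar, AddChar.map_add_eq_mul]

theorem traceChar_zero {F : Type*} [Field F] [Algebra (ZMod p) F] :
    traceChar p (0 : F) = 1 := by
  simp [traceChar]

theorem norm_traceChar {F : Type*} [Field F] [Algebra (ZMod p) F] (x : F) :
    ‖traceChar p x‖ = 1 := by
  simp [traceChar, AddChar.norm_apply]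

theorem exists_traceChar_mul_ne_one {c : F} (hc : c ≠ 0) : ∃ t : F, traceChar p (t * c) ≠ 1 := by
  obtain ⟨x, hx⟩ := Algebra.trace_surjective (ZMod p) F 1
  refine ⟨x / c, ?_⟩
  rw [div_mul_cancel₀ _ hc, traceChar, hx]
  intro h
  have := ZMod.injective_stdAddChar (N := p) (h.trans (AddChar.map_zero_eq_one _).symm)
  exact one_ne_zero this

theorem errorX_mul_errorZ_apply (a b : ι → F) (φ : QuditSpace ι F) (z : ι → F) :
    (errorX a * errorZ p b) φ z = traceChar p (∑ i, b i * (z i - a i)) * φ (z - a) := rfl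

theorem errorX_mul_errorZ_mul (a b a' b' : ι → F) (φ : QuditSpace ι F) :
    (errorX a * errorZ p b) ((errorX a' * errorZ p b') φ) =
      traceChar p (∑ i, b i * a' i) • (errorX (a + a') * errorZ p (b + b')) φ := by
  ext z
  simp only [errorX_mul_errorZ_apply, PiLp.smul_apply, smul_eq_mul, ← mul_assoc, ← traceChar_add,
    ← Finset.sum_add_distrib]
  rw [show z - a - a' = z - (a + a') by abel]
  congr 2
  refine Finset.sum_congr rfl fun i _ => ?_
  simp only [Pi.sub_apply, Pi.add_apply]
  ring

theorem errorX_zero_mul_errorZ_zero :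
    (errorX (0 : ι → F) * errorZ p (0 : ι → F) : QuditSpace ι F ≃ₗ[ℂ] QuditSpace ι F) = 1 := by
  ext φ z
  rw [errorX_mul_errorZ_apply]
  simp [traceChar_zero]

theorem errorZ_zero : (errorZ p (0 : ι → F) : QuditSpace ι F ≃ₗ[ℂ] QuditSpace ι F) = 1 := by
  ext φ z
  simp [errorZ, traceChar_zero]

theorem errorX_zero : (errorX (0 : ι → F) : QuditSpace ι F ≃ₗ[ℂ] QuditSpace ι F) = 1 := by
  ext φ z
  simp [errorX]

theorem inner_errorX_mul_errorZ (a b : ι → F) (φ ψ : QuditSpace ι F) :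
    inner ℂ ((errorX a * errorZ p b) φ) ((errorX a * errorZ p b) ψ) = inner ℂ φ ψ := by
  simp only [PiLp.inner_apply, errorX_mul_errorZ_apply]
  refine Fintype.sum_equiv (Equiv.subRight a) _ _ fun z => ?_
  have h : (starRingEnd ℂ) (traceChar p (∑ i, b i * (z i - a i))) *
      traceChar p (∑ i, b i * (z i - a i)) = 1 := by
    rw [← Complex.normSq_eq_conj_mul_self, Complex.normSq_eq_norm_sq, norm_traceChar]
    simp
  simp only [RCLike.inner_apply, map_mul, Equiv.subRight_apply]
  linear_combination (ψ (z - a) * (starRingEnd ℂ) (φ (z - a))) * h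

/-- Translating the summation variable in one coordinate multiplies the sum by a character value
other than 1. -/
theorem sum_traceChar_eq_zero [DecidableEq F] {b : ι → F} (hb : b ≠ 0) :
    ∑ z : ι → F, traceChar p (∑ i, b i * z i) = 0 := by
  obtain ⟨i, hi⟩ := Function.ne_iff.mp hb
  obtain ⟨t, ht⟩ := exists_traceChar_mul_ne_one p hi
  have hshift : ∑ z : ι → F, traceChar p (∑ i, b i * z i) =
      traceChar p (t * b i) * ∑ z : ι → F, traceChar p (∑ i, b i * z i) := by
    rw [Finset.mul_sum]
    refine Fintype.sum_equiv (Equiv.subRight (Pi.single i t)) _ _ fun z => ?_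
    rw [← traceChar_add]
    congr 1
    simp [mul_sub, Finset.sum_sub_distrib, Pi.single_apply, mul_comm]
  by_contra h
  exact ht (mul_right_cancel₀ h (by rw [one_mul]; exact hshift.symm))

/-- If a ≠ 0 the operator moves every basis vector, so its diagonal vanishes; if a = 0 the diagonal
is a nontrivial character sum. -/
theorem trace_errorX_mul_errorZ [DecidableEq F] {a b : ι → F} (h : a ≠ 0 ∨ b ≠ 0) :
    LinearMap.trace ℂ (QuditSpace ι F) (errorX a * errorZ p b).toLinearMap = 0 := by
  rw [LinearMap.trace_eq_sum_inner _ (EuclideanSpace.basisFun (ι → F) ℂ)]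
  simp only [EuclideanSpace.basisFun_apply, LinearEquiv.coe_coe, EuclideanSpace.inner_single_left,
    map_one, one_mul, errorX_mul_errorZ_apply]
  by_cases ha : a = 0
  · subst ha
    have hb : b ≠ 0 := by simpa using h
    simpa using sum_traceChar_eq_zero p hb
  · refine Finset.sum_eq_zero fun z _ => ?_
    simp [ha]

end ErrorOperators

/-! ### Stabilizer codes from spaces of labels -/

section StabilizerCodes

variable (p : ℕ) [Fact p.Prime] {ι F : Type*} [Fintype ι] [DecidableEq ι] [Field F] [Fintype F]
  [Algebra (ZMod p) F]

/-- The group of the operators `X(a) Z(b)`, `(a, b) ∈ S`, for a space `S` on which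
`⟨b, a'⟩` vanishes. -/
def labelGroup (S : Submodule F ((ι → F) × (ι → F)))
    (hS : ∀ s ∈ S, ∀ s' ∈ S, ∑ i, s.2 i * s'.1 i = 0) :
    Subgroup (QuditSpace ι F ≃ₗ[ℂ] QuditSpace ι F) where
  carrier := {E | ∃ s ∈ S, E = errorX s.1 * errorZ p s.2}
  one_mem' := ⟨0, S.zero_mem, (errorX_zero_mul_errorZ_zero p).symm⟩
  mul_mem' := by
    rintro _ _ ⟨s, hs, rfl⟩ ⟨s', hs', rfl⟩
    refine ⟨s + s', S.add_mem hs hs', LinearEquiv.ext fun φ => ?_⟩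
    have := errorX_mul_errorZ_mul p s.1 s.2 s'.1 s'.2 φ
    rw [hS s hs s' hs', traceChar_zero, one_smul] at this
    exact this
  inv_mem' := by
    rintro _ ⟨s, hs, rfl⟩
    refine ⟨-s, S.neg_mem hs, inv_eq_of_mul_eq_one_right (LinearEquiv.ext fun φ => ?_)⟩
    have := errorX_mul_errorZ_mul p s.1 s.2 (-s).1 (-s).2 φ
    rw [hS s hs _ (S.neg_mem hs), traceChar_zero, one_smul] at this
    refine this.trans ?_
    simp [errorX_zero_mul_errorZ_zero]

variable {p} {S : Submodule F ((ι → F) × (ι → F))}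
  (hS : ∀ s ∈ S, ∀ s' ∈ S, ∑ i, s.2 i * s'.1 i = 0)

theorem errorX_mul_errorZ_apply_of_mem (hS : ∀ s ∈ S, ∀ s' ∈ S, ∑ i, s.2 i * s'.1 i = 0)
    {s s' : (ι → F) × (ι → F)} (hs : s ∈ S) (hs' : s' ∈ S)
    (φ : QuditSpace ι F) :
    (errorX s.1 * errorZ p s.2) ((errorX s'.1 * errorZ p s'.2) φ) =
      (errorX (s + s').1 * errorZ p (s + s').2) φ := by
  have := errorX_mul_errorZ_mul p s.1 s.2 s'.1 s'.2 φ
  rwa [hS s hs s' hs', traceChar_zero, one_smul] at this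

theorem mem_stabilizerCode_labelGroup {φ : QuditSpace ι F} :
    φ ∈ stabilizerCode (labelGroup p S hS) ↔
      ∀ s ∈ S, (errorX s.1 * errorZ p s.2) φ = φ :=
  ⟨fun h s hs => h _ ⟨s, hs, rfl⟩, by rintro h _ ⟨s, hs, rfl⟩; exact h s hs⟩

variable (p S) in
/-- The average of the operators `X(a) Z(b)`, `(a, b) ∈ S`. -/
noncomputable def labelAverage [DecidableEq F] : Module.End ℂ (QuditSpace ι F) :=
  haveI : Fintype S := Fintype.ofFinite S
  (Fintype.card S : ℂ)⁻¹ • ∑ s : S, (errorX s.1.1 * errorZ p s.1.2).toLinearMap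

theorem isProj_labelAverage [DecidableEq F] :
    LinearMap.IsProj (stabilizerCode (labelGroup p S hS)) (labelAverage p S) := by
  let _ : Fintype S := Fintype.ofFinite S
  have hc : (Fintype.card S : ℂ) ≠ 0 := by simp
  refine ⟨fun φ => ?_, fun φ hφ => ?_⟩
  · rw [mem_stabilizerCode_labelGroup]
    intro s hs
    simp only [labelAverage, LinearMap.smul_apply, LinearMap.sum_apply, map_smul, map_sum,
      LinearEquiv.coe_coe]
    congr 1
    refine Fintype.sum_equiv (Equiv.addLeft ⟨s, hs⟩) _ _ fun s' => ?_
    exact errorX_mul_errorZ_apply_of_mem hS hs s'.2 φ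
  · rw [mem_stabilizerCode_labelGroup] at hφ
    simp only [labelAverage, LinearMap.smul_apply, LinearMap.sum_apply, LinearEquiv.coe_coe]
    rw [Finset.sum_congr rfl fun s _ => hφ s.1 s.2]
    simp only [Finset.sum_const, Finset.card_univ, ← Nat.cast_smul_eq_nsmul ℂ, smul_smul]
    convert one_smul ℂ φ
    exact inv_mul_cancel₀ hc

/-- The rank of a projector is its trace, and in the average only the label 0 contributes, with q^n.
-/
theorem finrank_stabilizerCode_labelGroup [DecidableEq F] :
    Module.finrank ℂ (stabilizerCode (labelGroup p S hS)) =
      Fintype.card F ^ (Fintype.card ι - Module.finrank F S) := by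
  let _ : Fintype S := Fintype.ofFinite S
  have htr := (isProj_labelAverage (p := p) hS).trace
  have hcard : Fintype.card S = Fintype.card F ^ Module.finrank F S :=
    Module.card_eq_pow_finrank (K := F) (V := S)
  have hsum : ∑ s : S, LinearMap.trace ℂ (QuditSpace ι F)
      (errorX s.1.1 * errorZ p s.1.2).toLinearMap = (Fintype.card F : ℂ) ^ Fintype.card ι := by
    rw [Finset.sum_eq_single 0]
    · simp only [ZeroMemClass.coe_zero, Prod.fst_zero, Prod.snd_zero,
        errorX_zero_mul_errorZ_zero]
      have : (1 : QuditSpace ι F ≃ₗ[ℂ] QuditSpace ι F).toLinearMap = 1 := rfl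
      rw [this, LinearMap.trace_one]
      simp
    · intro s _ hs
      refine trace_errorX_mul_errorZ p ?_
      by_contra h
      push Not at h
      exact hs (Subtype.ext (Prod.ext h.1 h.2))
    · simp
  -- Divisibility in q^n = |S| · dim of the code shows that the exponent is not truncated.
  have hle : Module.finrank F S ≤ Fintype.card ι := by
    have h1 : (Fintype.card F : ℂ) ^ Fintype.card ι =
        (Fintype.card F : ℂ) ^ Module.finrank F S *
          (Module.finrank ℂ (stabilizerCode (labelGroup p S hS)) : ℂ) := by
      rw [← htr, ← hsum, labelAverage]
      simp only [map_smul, map_sum, smul_eq_mul]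
      rw [← mul_assoc, hcard, Nat.cast_pow, mul_inv_cancel₀, one_mul]
      exact pow_ne_zero _ (by simp)
    have h2 : Fintype.card F ^ Module.finrank F S ∣ Fintype.card F ^ Fintype.card ι :=
      ⟨_, by exact_mod_cast h1⟩
    exact (Nat.pow_dvd_pow_iff_le_right Fintype.one_lt_card).mp h2
  have h0 : (Fintype.card F : ℂ) ≠ 0 := by simp
  have : (Module.finrank ℂ (stabilizerCode (labelGroup p S hS)) : ℂ) =
      (Fintype.card F : ℂ) ^ (Fintype.card ι - Module.finrank F S) := by
    rw [← htr, labelAverage]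
    simp only [map_smul, map_sum, smul_eq_mul]
    rw [hsum, hcard, Nat.cast_pow, pow_sub₀ _ h0 hle, mul_comm]
  exact_mod_cast this

/-- Operators that violate the symplectic orthogonality to the stabilizer map the code to a
subspace orthogonal to it. -/
theorem inner_stabilizerCode_labelGroup_eq_zero {e f : ι → F} {s : (ι → F) × (ι → F)} (hs : s ∈ S)
    (h : ∑ i, (s.1 i * f i - s.2 i * e i) ≠ 0) {φ ψ : QuditSpace ι F}
    (hφ : φ ∈ stabilizerCode (labelGroup p S hS)) (hψ : ψ ∈ stabilizerCode (labelGroup p S hS)) :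
    inner ℂ φ ((errorX e * errorZ p f) ψ) = 0 := by
  rw [mem_stabilizerCode_labelGroup] at hφ hψ
  -- A nonzero symplectic product can still have trace 0; a multiple of the label makes the
  -- commutation phase differ from 1.
  obtain ⟨t, ht⟩ := exists_traceChar_mul_ne_one p h
  have hts := S.smul_mem t hs
  set σ := t • s with hσ
  have hcomm : (errorX e * errorZ p f) ((errorX σ.1 * errorZ p σ.2) ψ) =
      traceChar p (t * ∑ i, (s.1 i * f i - s.2 i * e i)) •
        (errorX σ.1 * errorZ p σ.2) ((errorX e * errorZ p f) ψ) := by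
    rw [errorX_mul_errorZ_mul, errorX_mul_errorZ_mul, smul_smul, ← traceChar_add, add_comm e,
      add_comm f]
    congr 2
    rw [Finset.mul_sum, ← Finset.sum_add_distrib]
    refine Finset.sum_congr rfl fun i _ => ?_
    simp only [hσ, Prod.smul_fst, Prod.smul_snd, Pi.smul_apply, smul_eq_mul]
    ring
  have h1 : inner ℂ φ ((errorX e * errorZ p f) ψ) =
      traceChar p (t * ∑ i, (s.1 i * f i - s.2 i * e i)) *
        inner ℂ φ ((errorX e * errorZ p f) ψ) := by
    conv_lhs => rw [← hψ σ hts, hcomm, inner_smul_right, ← hφ σ hts]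
    rw [inner_errorX_mul_errorZ]
  by_contra h0
  exact ht (mul_right_cancel₀ h0 (by rw [one_mul]; exact h1.symm))

/-- Operators that commute with the stabilizer and do not belong to it are not detected. -/
theorem not_detects_stabilizerCode_labelGroup [DecidableEq F] {e f : ι → F} (hef : (e, f) ∉ S)
    (h : ∀ s ∈ S, ∑ i, (s.1 i * f i - s.2 i * e i) = 0) :
    ¬ Detects (stabilizerCode (labelGroup p S hS)) (errorX e * errorZ p f) := by
  rintro ⟨t, ht⟩
  let _ : Fintype S := Fintype.ofFinite S
  set E : QuditSpace ι F ≃ₗ[ℂ] QuditSpace ι F := errorX e * errorZ p f with hE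
  have hmem : ∀ ψ ∈ stabilizerCode (labelGroup p S hS),
      E ψ ∈ stabilizerCode (labelGroup p S hS) := by
    intro ψ hψ
    rw [mem_stabilizerCode_labelGroup] at hψ ⊢
    intro s hs
    conv_rhs => rw [← hψ s hs]
    rw [hE, errorX_mul_errorZ_mul, errorX_mul_errorZ_mul, add_comm e, add_comm f]
    congr 2
    have := h s hs
    rw [Finset.sum_sub_distrib, sub_eq_zero] at this
    rw [← this]
    exact Finset.sum_congr rfl fun i _ => mul_comm _ _
  -- Detection makes E ψ - t ψ orthogonal to the code; it also lies in the code, so it vanishes.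
  have hEt : ∀ ψ ∈ stabilizerCode (labelGroup p S hS), E ψ = t • ψ := by
    intro ψ hψ
    have hsub := Submodule.sub_mem _ (hmem ψ hψ) (Submodule.smul_mem _ t hψ)
    rw [← sub_eq_zero, ← inner_self_eq_zero (𝕜 := ℂ)]
    rw [inner_sub_right (𝕜 := ℂ) (E ψ - t • ψ), inner_smul_right, ht _ hsub _ hψ, sub_self]
  have hproj := isProj_labelAverage (p := p) hS
  have hcomp : E.toLinearMap ∘ₗ labelAverage p S = t • labelAverage p S := by
    ext1 φ
    exact hEt _ (hproj.map_mem φ)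
  -- E times the projector is an average of operators with labels (e, f) + s, never 0 because (e, f)
  -- is outside `S`. Comparison with t times the rank then forces t = 0, so E kills a nonzero space.
  have htrace : LinearMap.trace ℂ _ (E.toLinearMap ∘ₗ labelAverage p S) = 0 := by
    have hsum : E.toLinearMap ∘ₗ labelAverage p S = (Fintype.card S : ℂ)⁻¹ •
        ∑ s : S, traceChar p (∑ i, f i * s.1.1 i) •
          (errorX (e + s.1.1) * errorZ p (f + s.1.2)).toLinearMap := by
      ext1 φ
      simp only [labelAverage, LinearMap.comp_apply, LinearMap.smul_apply, LinearMap.sum_apply,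
        map_smul, map_sum, LinearEquiv.coe_coe]
      congr 1
      exact Finset.sum_congr rfl fun s _ => errorX_mul_errorZ_mul p e f s.1.1 s.1.2 φ
    rw [hsum, map_smul, map_sum, Finset.sum_eq_zero, smul_zero]
    intro s _
    rw [map_smul, trace_errorX_mul_errorZ, smul_zero]
    by_contra h0
    push Not at h0
    refine hef ?_
    have : (e, f) = -s.1 := Prod.ext (eq_neg_of_add_eq_zero_left h0.1)
      (eq_neg_of_add_eq_zero_left h0.2)
    rw [this]
    exact S.neg_mem s.2
  rw [hcomp, map_smul, hproj.trace, finrank_stabilizerCode_labelGroup, smul_eq_mul] at htrace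
  have ht0 : t = 0 := by simpa using htrace
  have hbot : stabilizerCode (labelGroup p S hS) = ⊥ := by
    rw [Submodule.eq_bot_iff]
    intro ψ hψ
    have := hEt ψ hψ
    rwa [ht0, zero_smul, LinearEquiv.map_eq_zero_iff] at this
  have hfr := finrank_stabilizerCode_labelGroup (p := p) hS
  rw [hbot, finrank_bot] at hfr
  exact (pow_ne_zero _ Fintype.card_ne_zero) hfr.symm

theorem errorSupport_card_eq_zero {ι F : Type*} [Fintype ι] [Field F] [DecidableEq F]
    {a b : ι → F} : (errorSupport a b).card = 0 ↔ a = 0 ∧ b = 0 := by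
  simp only [Finset.card_eq_zero, errorSupport, Finset.filter_eq_empty_iff, funext_iff,
    Finset.mem_univ, true_implies, not_or, not_not, Pi.zero_apply, forall_and]

/-- The parameters of a stabilizer code whose nonzero stabilizers are heavier than the lightest
operators commuting with all stabilizers. -/
theorem isQuantumCode_isPureCode_labelGroup [DecidableEq F] {κ d : ℕ}
    (hdim : Module.finrank F S + κ = Fintype.card ι)
    (hlow : ∀ e f : ι → F, (∀ s ∈ S, ∑ i, (s.1 i * f i - s.2 i * e i) = 0) →
      0 < (errorSupport e f).card → d ≤ (errorSupport e f).card)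
    (hmin : ∃ e f : ι → F, (∀ s ∈ S, ∑ i, (s.1 i * f i - s.2 i * e i) = 0) ∧
      (errorSupport e f).card = d)
    (hd : 0 < d)
    (hstab : ∀ s ∈ S, s ≠ 0 → d < (errorSupport s.1 s.2).card) :
    IsQuantumCode p (stabilizerCode (labelGroup p S hS)) κ d ∧
      IsPureCode p (stabilizerCode (labelGroup p S hS)) d := by
  have hpure : IsPureCode p (stabilizerCode (labelGroup p S hS)) d := by
    intro e f h0 h1 φ hφ ψ hψ
    by_cases h : ∀ s ∈ S, ∑ i, (s.1 i * f i - s.2 i * e i) = 0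
    · exact absurd (hlow e f h h0) (not_le.mpr h1)
    · push Not at h
      obtain ⟨s, hs, h⟩ := h
      exact inner_stabilizerCode_labelGroup_eq_zero hS hs h hφ hψ
  refine ⟨⟨?_, ?_, ?_⟩, hpure⟩
  · rw [finrank_stabilizerCode_labelGroup]
    congr 1
    omega
  · obtain ⟨e, f, h, hw⟩ := hmin
    -- A commuting operator of weight exactly d cannot be a stabilizer, as nonzero stabilizers are
    -- heavier.
    refine ⟨e, f, hw, not_detects_stabilizerCode_labelGroup hS (fun hmem => ?_) h⟩
    by_cases h0 : ((e, f) : (ι → F) × (ι → F)) = 0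
    · have := errorSupport_card_eq_zero.mpr (Prod.mk_eq_zero.mp h0)
      omega
    · have := hstab _ hmem h0
      simp only at this
      omega
  · rintro w ⟨e, f, rfl, hnd⟩
    by_contra! hlt
    refine hnd ?_
    rcases Nat.eq_zero_or_pos (errorSupport e f).card with h0 | h0
    · obtain ⟨rfl, rfl⟩ := errorSupport_card_eq_zero.mp h0
      exact ⟨1, fun φ _ ψ _ => by rw [errorX_zero_mul_errorZ_zero, one_mul]; rfl⟩
    · exact ⟨0, fun φ hφ ψ hψ => by rw [hpure e f h0 hlt φ hφ ψ hψ, zero_mul]⟩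

theorem hasQuantumLocality_labelGroup [DecidableEq F] {r : ℕ}
    (hloc : ∀ i : ι, ∃ s ∈ S, ∃ s' ∈ S,
      (errorSupport s.1 s.2 ∪ errorSupport s'.1 s'.2).card ≤ r + 1 ∧
      s.1 i = 1 ∧ s.2 i = 0 ∧ s'.1 i = 0 ∧ s'.2 i = 1) :
    HasQuantumLocality p (stabilizerCode (labelGroup p S hS)) r := by
  refine ⟨labelGroup p S hS, ?_, ?_, rfl, fun i => ?_⟩
  · rintro _ ⟨s, -, rfl⟩
    exact ⟨0, s.1, s.2, fun φ => by rw [AddChar.map_zero_eq_one, one_smul]⟩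
  · rintro _ ⟨s, hs, rfl⟩ _ ⟨s', hs', rfl⟩
    refine LinearEquiv.ext fun φ => ?_
    rw [LinearEquiv.mul_apply (errorX s.1 * errorZ p s.2),
      LinearEquiv.mul_apply (errorX s'.1 * errorZ p s'.2), errorX_mul_errorZ_apply_of_mem hS hs hs' φ,
      errorX_mul_errorZ_apply_of_mem hS hs' hs φ, add_comm s s']
  · obtain ⟨s, hs, s', hs', hcard, h1, h2, h3, h4⟩ := hloc i
    exact ⟨s.1, s.2, s'.1, s'.2, ⟨s, hs, rfl⟩, ⟨s', hs', rfl⟩, hcard, h1, h2, h3, h4⟩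

end StabilizerCodes

/-! ### Dual codes -/

section DualCode

variable {ι F : Type*} [Fintype ι] [Field F]

theorem finrank_add_finrank_dualCode (C : Submodule F (ι → F)) :
    Module.finrank F C + Module.finrank F (dualCode C) = Fintype.card ι := by
  classical
  have h : dualCode C =
      Submodule.comap (dotProductEquiv F ι).toLinearMap C.dualAnnihilator := by
    ext a
    rw [Submodule.mem_comap, Submodule.mem_dualAnnihilator]
    rfl
  rw [h, (LinearEquiv.ofSubmodule' (dotProductEquiv F ι) C.dualAnnihilator).finrank_eq,
    Subspace.finrank_add_finrank_dualAnnihilator_eq, Module.finrank_fintype_fun_eq_card]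

theorem dualCode_dualCode (C : Submodule F (ι → F)) : dualCode (dualCode C) = C := by
  symm
  refine Submodule.eq_of_le_of_finrank_eq (fun c hc a ha => ?_) ?_
  · rw [← ha c hc]
    exact Finset.sum_congr rfl fun i _ => mul_comm _ _
  · have h1 := finrank_add_finrank_dualCode C
    have h2 := finrank_add_finrank_dualCode (dualCode C)
    omega

end DualCode

/-! ### Generalized Reed-Solomon codes -/

section GRS

variable {F : Type*} [Field F]

/-- By Lagrange interpolation the sum is the coefficient of X^(|s| - 1) in P, which vanishes for
degree reasons. -/
theorem sum_nodalWeight_mul_eval_eq_zero {ι : Type*} [DecidableEq ι] {s : Finset ι} {a : ι → F}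
    (ha : Set.InjOn a s) {P : Polynomial F} (hP : P.natDegree + 1 < s.card) :
    ∑ i ∈ s, Lagrange.nodalWeight s a i * P.eval (a i) = 0 := by
  have h := Lagrange.coeff_eq_sum ha (P := P)
    (lt_of_le_of_lt Polynomial.degree_le_natDegree (by exact_mod_cast (by omega)))
  rw [Polynomial.coeff_eq_zero_of_natDegree_lt (by omega)] at h
  rw [h]
  refine Finset.sum_congr rfl fun i _ => ?_
  rw [Lagrange.nodalWeight, Finset.prod_inv_distrib, div_eq_mul_inv, mul_comm]

theorem finrank_grsCode {n k : ℕ} {a v : Fin n → F} (ha : Function.Injective a)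
    (hv : ∀ j, v j ≠ 0) (hk : k ≤ n) : Module.finrank F (grsCode k a v) = k := by
  have hli : LinearIndependent F fun (l : Fin k) (j : Fin n) => v j * a j ^ (l : ℕ) := by
    rw [Fintype.linearIndependent_iff]
    intro g hg
    set P : Polynomial F := ∑ l : Fin k, Polynomial.monomial (l : ℕ) (g l) with hP
    have hcoeff : ∀ l : Fin k, P.coeff l = g l := by
      intro l
      simp only [hP, Polynomial.finsetSum_coeff, Polynomial.coeff_monomial]
      simp [Fin.val_inj]
    have heval : ∀ j, P.eval (a j) = 0 := by
      intro j
      have := congrFun hg j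
      simp only [Finset.sum_apply, Pi.smul_apply, smul_eq_mul, Pi.zero_apply] at this
      have h2 : v j * P.eval (a j) = 0 := by
        rw [← this, hP, Polynomial.eval_finsetSum, Finset.mul_sum]
        refine Finset.sum_congr rfl fun l _ => ?_
        rw [Polynomial.eval_monomial]
        ring
      exact (mul_eq_zero.mp h2).resolve_left (hv j)
    intro l
    have hdeg : P.natDegree < Fintype.card (Fin n) := by
      rw [Fintype.card_fin]
      have : P.natDegree ≤ k - 1 := by
        refine Polynomial.natDegree_sum_le_of_forall_le _ _ fun l _ => ?_
        exact (Polynomial.natDegree_monomial_le _).trans (by omega)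
      have := l.2
      omega
    rw [← hcoeff, Polynomial.eq_zero_of_natDegree_lt_card_of_eval_eq_zero P ha heval hdeg,
      Polynomial.coeff_zero]
  rw [grsCode, finrank_span_eq_card hli, Fintype.card_fin]

/-- A row l < n - k and a row m < k pair to the nodal-weight sum of X^(l + m), and l + m ≤ n - 2.
Dimensions then force equality. -/
theorem dualCode_grsCode {n k : ℕ} {a v : Fin n → F} (ha : Function.Injective a)
    (hv : ∀ j, v j ≠ 0) (hk : k ≤ n) :
    dualCode (grsCode k a v) =
      grsCode (n - k) a fun j => (v j)⁻¹ * Lagrange.nodalWeight Finset.univ a j := by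
  have hw : ∀ j, (v j)⁻¹ * Lagrange.nodalWeight Finset.univ a j ≠ 0 := fun j =>
    mul_ne_zero (inv_ne_zero (hv j))
      (Lagrange.nodalWeight_ne_zero ha.injOn (Finset.mem_univ j))
  symm
  refine Submodule.eq_of_le_of_finrank_eq ?_ ?_
  · rw [grsCode, Submodule.span_le]
    rintro _ ⟨l, rfl⟩
    suffices h : grsCode k a v ≤ dualCode (Submodule.span F
        {fun j => (v j)⁻¹ * Lagrange.nodalWeight Finset.univ a j * a j ^ (l : ℕ)}) by
      intro c hc
      rw [← h hc _ (Submodule.mem_span_singleton_self _)]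
      exact Finset.sum_congr rfl fun i _ => mul_comm _ _
    rw [grsCode, Submodule.span_le]
    rintro _ ⟨m, rfl⟩ c hc
    obtain ⟨t, rfl⟩ := Submodule.mem_span_singleton.mp hc
    have h := sum_nodalWeight_mul_eval_eq_zero (s := Finset.univ) (a := a) ha.injOn
      (P := Polynomial.X ^ ((l : ℕ) + (m : ℕ)))
      (by rw [Polynomial.natDegree_X_pow, Finset.card_univ, Fintype.card_fin]; omega)
    rw [← mul_zero t, ← h, Finset.mul_sum]
    refine Finset.sum_congr rfl fun j _ => ?_
    have := hv j
    simp only [Pi.smul_apply, smul_eq_mul, Polynomial.eval_pow, Polynomial.eval_X]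
    field_simp
    ring
  · have h := finrank_add_finrank_dualCode (grsCode k a v)
    rw [finrank_grsCode ha hv hk, Fintype.card_fin] at h
    rw [finrank_grsCode ha hw (Nat.sub_le n k)]
    omega

end GRS

/-! ### The block codes -/

section BlockCode

open Polynomial
open scoped Matrix

variable {F : Type*} [Field F] {u m d : ℕ}

/-- The polynomial that describes the block `g` of a combination of the rows of
`blockParityCheck`. -/
noncomputable def blockPoly (y : Fin u ⊕ Fin (d - 2) → F) (g : Fin u) : F[X] :=
  C (y (Sum.inl g)) + ∑ l : Fin (d - 2), C (y (Sum.inr l)) * X ^ ((l : ℕ) + 1)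

/-- The row space of `blockParityCheck`. -/
noncomputable def blockRowSpace (d : ℕ) (a v : Fin u → Fin m → F) :
    Submodule F (Fin u × Fin m → F) :=
  LinearMap.range (blockParityCheck d a v).vecMulLinear

theorem vecMul_blockParityCheck (a v : Fin u → Fin m → F) (y : Fin u ⊕ Fin (d - 2) → F)
    (x : Fin u × Fin m) :
    (blockParityCheck d a v).vecMulLinear y x =
      v x.1 x.2 * (blockPoly y x.1).eval (a x.1 x.2) := by
  simp only [Matrix.vecMulLinear_apply, Matrix.vecMul, dotProduct, Fintype.sum_sum_type,
    blockParityCheck, Matrix.of_apply, blockPoly, eval_add, eval_C, eval_finsetSum, eval_mul,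
    eval_pow, eval_X, mul_add, Finset.mul_sum, mul_ite, mul_zero]
  rw [Finset.sum_ite_eq Finset.univ x.1, if_pos (Finset.mem_univ _), mul_comm]
  congr 1
  exact Finset.sum_congr rfl fun l _ => by ring

theorem natDegree_blockPoly_le (y : Fin u ⊕ Fin (d - 2) → F) (g : Fin u) :
    (blockPoly y g).natDegree ≤ d - 2 := by
  refine (natDegree_add_le _ _).trans (max_le (by simp) ?_)
  refine natDegree_sum_le_of_forall_le _ _ fun l _ => ?_
  exact (natDegree_C_mul_X_pow_le _ _).trans (by omega)

theorem blockPoly_coeff_zero (y : Fin u ⊕ Fin (d - 2) → F) (g : Fin u) :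
    (blockPoly y g).coeff 0 = y (Sum.inl g) := by
  simp [blockPoly, coeff_X_pow]

theorem blockPoly_coeff_succ (y : Fin u ⊕ Fin (d - 2) → F) (g : Fin u) (l : Fin (d - 2)) :
    (blockPoly y g).coeff ((l : ℕ) + 1) = y (Sum.inr l) := by
  simp [blockPoly, coeff_X_pow, Fin.val_inj]

theorem exists_blockPoly_ne_zero (hu : 0 < u) {y : Fin u ⊕ Fin (d - 2) → F} (hy : y ≠ 0) :
    ∃ g, blockPoly y g ≠ 0 := by
  by_contra! h
  refine hy (funext fun s => ?_)
  rcases s with g | l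
  · rw [← blockPoly_coeff_zero y g, h, coeff_zero, Pi.zero_apply]
  · rw [← blockPoly_coeff_succ y ⟨0, hu⟩, h, coeff_zero, Pi.zero_apply]

/-- Some block polynomial is nonzero, and it has at most d - 2 roots among the m distinct points of
that block. -/
theorem le_hammingNorm_blockRowSpace [DecidableEq F] (hu : 0 < u) {a v : Fin u → Fin m → F}
    (ha : ∀ i, Function.Injective (a i)) (hv : ∀ i j, v i j ≠ 0)
    {y : Fin u ⊕ Fin (d - 2) → F} (hy : y ≠ 0) :
    m ≤ hammingNorm ((blockParityCheck d a v).vecMulLinear y) + (d - 2) := by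
  obtain ⟨g, hg⟩ := exists_blockPoly_ne_zero hu hy
  set P := blockPoly y g with hP
  have hroots : (Finset.univ.filter fun j => P.eval (a g j) = 0).card ≤ d - 2 := by
    refine le_trans ?_ (natDegree_blockPoly_le y g)
    rw [← Finset.card_image_of_injective _ (ha g)]
    refine le_trans ?_ (card_roots' P)
    refine le_trans (Finset.card_le_card ?_) (Multiset.toFinset_card_le _)
    intro z hz
    obtain ⟨j, hj, rfl⟩ := Finset.mem_image.mp hz
    rw [Multiset.mem_toFinset, mem_roots hg]
    exact (Finset.mem_filter.mp hj).2
  have hnon : (Finset.univ.filter fun j => ¬ P.eval (a g j) = 0).card ≤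
      hammingNorm ((blockParityCheck d a v).vecMulLinear y) := by
    rw [hammingNorm, ← Finset.card_image_of_injective _ (Prod.mk_right_injective g)]
    refine Finset.card_le_card fun x hx => ?_
    obtain ⟨j, hj, rfl⟩ := Finset.mem_image.mp hx
    rw [Finset.mem_filter]
    refine ⟨Finset.mem_univ _, ?_⟩
    rw [vecMul_blockParityCheck]
    exact mul_ne_zero (hv g j) (Finset.mem_filter.mp hj).2
  have := Finset.card_filter_add_card_filter_not (s := (Finset.univ : Finset (Fin m)))
    (fun j => P.eval (a g j) = 0)
  rw [Finset.card_univ, Fintype.card_fin] at this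
  omega

theorem finrank_blockRowSpace (hu : 0 < u) {a v : Fin u → Fin m → F}
    (ha : ∀ i, Function.Injective (a i)) (hv : ∀ i j, v i j ≠ 0) (hdm : d - 2 < m) :
    Module.finrank F (blockRowSpace d a v) = u + (d - 2) := by
  classical
  rw [blockRowSpace, LinearMap.finrank_range_of_inj]
  · simp
  · rw [← LinearMap.ker_eq_bot, LinearMap.ker_eq_bot']
    intro y hy
    by_contra h
    have := le_hammingNorm_blockRowSpace hu ha hv h
    rw [hy, hammingNorm_zero] at this
    omega

/-! ### Duality between the row space and the block code -/

theorem dualCode_blockRowSpace (a v : Fin u → Fin m → F) :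
    dualCode (blockRowSpace d a v) = blockCode d a v := by
  ext c
  rw [blockCode, LinearMap.mem_ker, Matrix.mulVecLin_apply]
  constructor
  · intro h
    rw [← dotProduct_eq_zero_iff]
    intro y
    have := h _ ⟨y, rfl⟩
    rw [dotProduct_comm, Matrix.dotProduct_mulVec, dotProduct_comm]
    exact this
  · rintro h _ ⟨y, rfl⟩
    change c ⬝ᵥ (y ᵥ* blockParityCheck d a v) = 0
    rw [dotProduct_comm, ← Matrix.dotProduct_mulVec, h, dotProduct_zero]

theorem dualCode_blockCode (a v : Fin u → Fin m → F) :
    dualCode (blockCode d a v) = blockRowSpace d a v := by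
  rw [← dualCode_blockRowSpace, dualCode_dualCode]

theorem mem_blockCode {a v : Fin u → Fin m → F} {c : Fin u × Fin m → F} :
    c ∈ blockCode d a v ↔ (∀ g, ∑ j, v g j * c (g, j) = 0) ∧
      ∀ l : Fin (d - 2), ∑ x, v x.1 x.2 * a x.1 x.2 ^ ((l : ℕ) + 1) * c x = 0 := by
  rw [blockCode, LinearMap.mem_ker, Matrix.mulVecLin_apply, funext_iff, Sum.forall]
  refine and_congr (forall_congr' fun g => ?_) Iff.rfl
  simp only [Matrix.mulVec, dotProduct, blockParityCheck, Matrix.of_apply, ite_mul, zero_mul,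
    Fintype.sum_prod_type, Pi.zero_apply]
  rw [Finset.sum_eq_single g]
  · simp
  · intro g' _ hg'
    simp [hg']
  · simp

/-- The global checks give the moments 1, ..., d - 2; the moment 0 is the sum of the local checks.
-/
theorem sum_eval_eq_zero_of_mem_blockCode {a v : Fin u → Fin m → F} {c : Fin u × Fin m → F}
    (hc : c ∈ blockCode d a v) {P : F[X]} (hP : P.natDegree ≤ d - 2) :
    ∑ x, v x.1 x.2 * c x * P.eval (a x.1 x.2) = 0 := by
  rw [mem_blockCode] at hc
  simp only [eval_eq_sum_range' (Nat.lt_succ_of_le hP), Finset.mul_sum]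
  rw [Finset.sum_comm]
  refine Finset.sum_eq_zero fun l hl => ?_
  have hfac : ∀ x : Fin u × Fin m, v x.1 x.2 * c x * (P.coeff l * a x.1 x.2 ^ l) =
      P.coeff l * (v x.1 x.2 * a x.1 x.2 ^ l * c x) := fun x => by ring
  simp only [hfac]
  rw [← Finset.mul_sum]
  refine mul_eq_zero_of_right _ ?_
  rcases l with _ | l
  · simp only [pow_zero, mul_one, Fintype.sum_prod_type]
    exact Finset.sum_eq_zero fun g _ => hc.1 g
  · exact hc.2 ⟨l, by rw [Finset.mem_range] at hl; omega⟩

/-! ### Minimum distance of the block code -/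

theorem two_le_card_of_sum_eq_zero {α : Type*} {s : Finset α} {w : α → F} (hs : s.Nonempty)
    (hw : ∀ x ∈ s, w x ≠ 0) (h : ∑ x ∈ s, w x = 0) : 2 ≤ s.card := by
  by_contra! hlt
  have hpos := hs.card_pos
  obtain ⟨x, rfl⟩ := Finset.card_eq_one.mp (show s.card = 1 by omega)
  rw [Finset.sum_singleton] at h
  exact hw x (Finset.mem_singleton_self x) h

/-- The minimum distance of the block code: few point sets overlap in few points. -/
theorem le_hammingNorm_of_mem_blockCode [DecidableEq F] {r : ℕ} (hd : 2 ≤ d)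
    {a v : Fin u → Fin (r + 1) → F} (hv : ∀ i j, v i j ≠ 0)
    (hU : ∀ S : Finset (Fin u), S.Nonempty → S.card ≤ (d - 1) / 2 →
      r * S.card + 1 ≤ (S.biUnion fun g => Finset.univ.image (a g)).card)
    {c : Fin u × Fin (r + 1) → F} (hc : c ∈ blockCode d a v) (hc0 : c ≠ 0) :
    d ≤ hammingNorm c := by
  by_contra! hlt
  set T : Finset (Fin u × Fin (r + 1)) := Finset.univ.filter fun x => c x ≠ 0 with hT
  have hTcard : T.card < d := hlt
  have hne : ∀ x ∈ T, v x.1 x.2 * c x ≠ 0 := fun x hx =>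
    mul_ne_zero (hv _ _) (Finset.mem_filter.mp hx).2
  have hTsum : ∀ f : Fin u × Fin (r + 1) → F,
      ∑ x ∈ T, v x.1 x.2 * c x * f x = ∑ x, v x.1 x.2 * c x * f x := by
    intro f
    refine Finset.sum_subset (Finset.subset_univ _) fun x _ hx => ?_
    have : c x = 0 := by simpa [hT] using hx
    rw [this, mul_zero, zero_mul]
  have hTne : T.Nonempty := by
    obtain ⟨x, hx⟩ := Function.ne_iff.mp hc0
    exact ⟨x, Finset.mem_filter.mpr ⟨Finset.mem_univ _, hx⟩⟩
  set S := T.image Prod.fst with hS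
  set A := T.image fun x => a x.1 x.2 with hA
  -- The local check of a block is a vanishing sum of nonzero terms over the support in that block,
  -- so there are at least two terms.
  have hS2 : 2 * S.card ≤ T.card := by
    refine Finset.mul_card_image_le_card _ _ fun g hg => ?_
    obtain ⟨x, hx, rfl⟩ := Finset.mem_image.mp hg
    refine two_le_card_of_sum_eq_zero (w := fun x => v x.1 x.2 * c x)
      ⟨x, Finset.mem_filter.mpr ⟨hx, rfl⟩⟩ (fun y hy => hne y (Finset.mem_filter.mp hy).1) ?_
    rw [Finset.sum_filter]
    have h1 := hTsum fun y => if y.1 = x.1 then 1 else 0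
    simp only [mul_ite, mul_one, mul_zero] at h1
    rw [h1, Fintype.sum_prod_type, Finset.sum_eq_single x.1]
    · simpa using (mem_blockCode.mp hc).1 x.1
    · intro g' _ hg'
      simp [hg']
    · simp
  have hA2 : 2 * A.card ≤ T.card := by
    have hAcard : A.card ≤ d - 1 := by
      have : A.card ≤ T.card := Finset.card_image_le
      omega
    refine Finset.mul_card_image_le_card _ _ fun z hz => ?_
    obtain ⟨x, hx, rfl⟩ := Finset.mem_image.mp hz
    refine two_le_card_of_sum_eq_zero (w := fun x => v x.1 x.2 * c x)
      ⟨x, Finset.mem_filter.mpr ⟨hx, rfl⟩⟩ (fun y hy => hne y (Finset.mem_filter.mp hy).1) ?_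
    set z := a x.1 x.2 with hz'
    -- This polynomial isolates the positions with evaluation point z. Its degree is at most d - 2
    -- because fewer than d points occur.
    set P : F[X] := ∏ z' ∈ A.erase z, (X - C z') with hP
    have hPdeg : P.natDegree ≤ d - 2 := by
      rw [hP, natDegree_prod_of_monic _ _ fun i _ => monic_X_sub_C i]
      simp only [natDegree_X_sub_C, Finset.sum_const, smul_eq_mul, mul_one]
      have := Finset.card_erase_of_mem (s := A) hz
      omega
    have hPz : P.eval z ≠ 0 := by
      rw [hP, eval_prod, Finset.prod_ne_zero_iff]
      intro z' hz'
      rw [eval_sub, eval_X, eval_C, sub_ne_zero]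
      exact (Finset.ne_of_mem_erase hz').symm
    have h1 := sum_eval_eq_zero_of_mem_blockCode hc hPdeg
    rw [← hTsum fun y => P.eval (a y.1 y.2)] at h1
    have h2 : ∑ y ∈ T, v y.1 y.2 * c y * P.eval (a y.1 y.2) =
        ∑ y ∈ T.filter fun y => a y.1 y.2 = z, v y.1 y.2 * c y * P.eval z := by
      rw [Finset.sum_filter (fun y : Fin u × Fin (r + 1) => a y.1 y.2 = z)]
      refine Finset.sum_congr rfl fun y hy => ?_
      split_ifs with h
      · rw [h]
      · refine mul_eq_zero_of_right _ ?_
        rw [hP, eval_prod]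
        refine Finset.prod_eq_zero (i := a y.1 y.2)
          (Finset.mem_erase.mpr ⟨h, Finset.mem_image.mpr ⟨y, hy, rfl⟩⟩) ?_
        simp
    rw [h2, ← Finset.sum_mul] at h1
    exact (mul_eq_zero.mp h1).resolve_right hPz
  have hfull : (S ×ˢ (Finset.univ : Finset (Fin (r + 1)))).card = S.card * (r + 1) := by
    rw [Finset.card_product, Finset.card_univ, Fintype.card_fin]
  have hTfull : T ⊆ S ×ˢ (Finset.univ : Finset (Fin (r + 1))) := fun x hx =>
    Finset.mem_product.mpr ⟨Finset.mem_image_of_mem _ hx, Finset.mem_univ _⟩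
  -- Each point of the union is met by the support or comes from one of the (r + 1)|S| - |T|
  -- remaining positions. With the overlap hypothesis this gives |T| + 1 ≤ |A| + |S| ≤ |T|.
  have hBcard : (S.biUnion fun g => Finset.univ.image (a g)).card ≤
      A.card + ((S ×ˢ (Finset.univ : Finset (Fin (r + 1)))) \ T).card := by
    refine le_trans (Finset.card_le_card (t := A ∪
      ((S ×ˢ (Finset.univ : Finset (Fin (r + 1)))) \ T).image fun x => a x.1 x.2) ?_)
      ((Finset.card_union_le _ _).trans (Nat.add_le_add_left Finset.card_image_le _))
    intro z hz
    simp only [Finset.mem_biUnion, Finset.mem_image, Finset.mem_univ, true_and] at hz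
    obtain ⟨g, hg, j, rfl⟩ := hz
    rw [Finset.mem_union]
    by_cases hx : (g, j) ∈ T
    · exact Or.inl (Finset.mem_image.mpr ⟨_, hx, rfl⟩)
    · refine Or.inr (Finset.mem_image.mpr ⟨(g, j), ?_, rfl⟩)
      exact Finset.mem_sdiff.mpr ⟨Finset.mem_product.mpr ⟨hg, Finset.mem_univ _⟩, hx⟩
  rw [Finset.card_sdiff_of_subset hTfull, hfull] at hBcard
  have hle := Finset.card_le_card hTfull
  rw [hfull] at hle
  have := hU S (hTne.image _) (by omega)
  rw [mul_comm r] at this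
  rw [mul_add, mul_one] at hle hBcard
  omega

/-- Inside one block, the nodal weights of d points, divided by v, annihilate all polynomials of
degree at most d - 2. -/
theorem exists_mem_blockCode_hammingNorm_eq [DecidableEq F] (hu : 0 < u) (hd : 2 ≤ d) (hdm : d ≤ m)
    {a v : Fin u → Fin m → F} (ha : ∀ i, Function.Injective (a i)) (hv : ∀ i j, v i j ≠ 0) :
    ∃ c ∈ blockCode d a v, hammingNorm c = d := by
  obtain ⟨s, -, hs⟩ := Finset.exists_subset_card_eq (s := (Finset.univ : Finset (Fin m)))
    (n := d) (by simpa using hdm)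
  set g : Fin u := ⟨0, hu⟩ with hg
  set c : Fin u × Fin m → F := fun x =>
    if x.1 = g ∧ x.2 ∈ s then (v g x.2)⁻¹ * Lagrange.nodalWeight s (a g) x.2 else 0 with hc
  have hcne : ∀ x, c x ≠ 0 ↔ x.1 = g ∧ x.2 ∈ s := by
    intro x
    simp only [hc]
    split_ifs with h
    · simp only [ne_eq, h, and_self, iff_true]
      exact mul_ne_zero (inv_ne_zero (hv _ _)) (Lagrange.nodalWeight_ne_zero (ha g).injOn h.2)
    · simp [h]
  have hsum : ∀ P : F[X], P.natDegree ≤ d - 2 →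
      ∑ j, v g j * P.eval (a g j) * c (g, j) = 0 := by
    intro P hP
    rw [← sum_nodalWeight_mul_eval_eq_zero (s := s) (ha g).injOn
      (show P.natDegree + 1 < s.card by omega),
      ← Finset.sum_subset (Finset.subset_univ s)]
    · refine Finset.sum_congr rfl fun j hj => ?_
      have := hv g j
      simp only [hc, hj, and_self, if_true]
      field_simp
    · intro j _ hj
      simp [hc, hj]
  have hzero : ∀ g' ≠ g, ∀ j, c (g', j) = 0 := fun g' hg' j => by simp [hc, hg']
  refine ⟨c, mem_blockCode.mpr ⟨fun g' => ?_, fun l => ?_⟩, ?_⟩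
  · by_cases h : g' = g
    · subst h
      simpa using hsum 1 (by simp)
    · exact Finset.sum_eq_zero fun j _ => by rw [hzero _ h, mul_zero]
  · rw [Fintype.sum_prod_type, Finset.sum_eq_single g]
    · simpa using hsum (X ^ ((l : ℕ) + 1)) (by rw [natDegree_X_pow]; omega)
    · intro g' _ h
      exact Finset.sum_eq_zero fun j _ => by rw [hzero _ h, mul_zero]
    · simp
  · rw [hammingNorm, ← hs, ← Finset.card_image_of_injective s (Prod.mk_right_injective g)]
    congr 1
    ext x
    simp only [Finset.mem_filter, Finset.mem_univ, true_and, hcne, Finset.mem_image]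
    constructor
    · rintro ⟨h1, h2⟩
      exact ⟨x.2, h2, Prod.ext h1.symm rfl⟩
    · rintro ⟨j, hj, rfl⟩
      exact ⟨rfl, hj⟩

/-- The parameters of the block code. -/
theorem isLinearCode_blockCode [DecidableEq F] {r : ℕ} (hu : 0 < u) (hd : 2 ≤ d) (hdr : d ≤ r + 1)
    {a v : Fin u → Fin (r + 1) → F} (ha : ∀ i, Function.Injective (a i)) (hv : ∀ i j, v i j ≠ 0)
    (hU : ∀ S : Finset (Fin u), S.Nonempty → S.card ≤ (d - 1) / 2 →
      r * S.card + 1 ≤ (S.biUnion fun g => Finset.univ.image (a g)).card) :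
    IsLinearCode (blockCode d a v) (u * r + 2 - d) d := by
  refine ⟨?_, ?_, ?_⟩
  · have h := finrank_add_finrank_dualCode (blockRowSpace d a v)
    rw [dualCode_blockRowSpace, finrank_blockRowSpace hu ha hv (by omega), Fintype.card_prod,
      Fintype.card_fin, Fintype.card_fin, mul_add, mul_one] at h
    omega
  · obtain ⟨c, hc, hw⟩ := exists_mem_blockCode_hammingNorm_eq hu hd hdr ha hv
    refine ⟨c, hc, ?_, hw⟩
    rintro rfl
    rw [hammingNorm_zero] at hw
    omega
  · rintro _ ⟨c, hc, hc0, rfl⟩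
    exact le_hammingNorm_of_mem_blockCode hd hv hU hc hc0

/-- A row `t v_g` of the local part of the row space. -/
theorem localRow_mem_blockRowSpace (a v : Fin u → Fin m → F) (g : Fin u) (t : F) :
    (fun x : Fin u × Fin m => if x.1 = g then t * v x.1 x.2 else 0) ∈ blockRowSpace d a v := by
  refine ⟨fun s => Sum.elim (Pi.single g t) (fun _ => 0) s, funext fun x => ?_⟩
  rw [vecMul_blockParityCheck]
  by_cases h : x.1 = g <;> simp [blockPoly, h, mul_comm]

theorem card_filter_fst_eq (g : Fin u) :
    (Finset.univ.filter fun x : Fin u × Fin m => x.1 = g).card = m := by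
  have : (Finset.univ.filter fun x : Fin u × Fin m => x.1 = g) =
      Finset.univ.image (Prod.mk g) := by
    ext x
    simp only [Finset.mem_filter, Finset.mem_univ, true_and, Finset.mem_image]
    exact ⟨fun h => ⟨x.2, Prod.ext h.symm rfl⟩, by rintro ⟨j, rfl⟩; rfl⟩
  rw [this, Finset.card_image_of_injective _ (Prod.mk_right_injective g), Finset.card_univ,
    Fintype.card_fin]

theorem hasLocality_blockCode [DecidableEq F] {r : ℕ} {a v : Fin u → Fin (r + 1) → F}
    (hv : ∀ i j, v i j ≠ 0) : HasLocality (blockCode d a v) r := by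
  intro i
  refine ⟨_, by rw [dualCode_blockCode]; exact localRow_mem_blockRowSpace a v i.1 1, ?_, ?_⟩
  · refine le_of_le_of_eq (Finset.card_le_card fun x hx => ?_) (card_filter_fst_eq i.1)
    rw [Finset.mem_filter] at hx ⊢
    exact ⟨hx.1, by by_contra h; simp [h] at hx⟩
  · simpa using hv i.1 i.2

end BlockCode

/-! ### CSS codes -/

section CSS

theorem finrank_submodule_prod {F V W : Type*} [Field F] [AddCommGroup V] [Module F V] [AddCommGroup W]
    [Module F W] [FiniteDimensional F V] [FiniteDimensional F W] (A : Submodule F V)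
    (B : Submodule F W) :
    Module.finrank F (A.prod B) = Module.finrank F A + Module.finrank F B := by
  have h : A.prod B = LinearMap.range (A.subtype.prodMap B.subtype) := by
    rw [LinearMap.range_prodMap, Submodule.range_subtype, Submodule.range_subtype]
  rw [h, LinearMap.finrank_range_of_inj, Module.finrank_prod]
  exact Function.Injective.prodMap A.injective_subtype B.injective_subtype

variable {p : ℕ} [Fact p.Prime] {ι F : Type*} [Fintype ι] [DecidableEq ι] [Field F] [Fintype F]
  [Algebra (ZMod p) F] {C₁ C₂ : Submodule F (ι → F)}

theorem sum_mul_eq_zero_of_mem_prod_dualCode {ι F : Type*} [Fintype ι] [Field F]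
    {C₁ C₂ : Submodule F (ι → F)} (h : dualCode C₁ ≤ C₂) :
    ∀ s ∈ (dualCode C₁).prod (dualCode C₂), ∀ s' ∈ (dualCode C₁).prod (dualCode C₂),
      ∑ i, s.2 i * s'.1 i = 0 :=
  fun _ hs _ hs' => hs.2 _ (h hs'.1)

theorem cssCode_eq_stabilizerCode_labelGroup (h : dualCode C₁ ≤ C₂) :
    cssCode p C₁ C₂ = stabilizerCode (labelGroup p ((dualCode C₁).prod (dualCode C₂))
      (sum_mul_eq_zero_of_mem_prod_dualCode h)) := by
  rw [cssCode]
  congr 1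
  refine le_antisymm ((Subgroup.closure_le _).mpr ?_) ?_
  · rintro _ (⟨a, ha, rfl⟩ | ⟨b, hb, rfl⟩)
    · exact ⟨(a, 0), ⟨ha, Submodule.zero_mem _⟩, by rw [errorZ_zero, mul_one]⟩
    · exact ⟨(0, b), ⟨Submodule.zero_mem _, hb⟩, by rw [errorX_zero, one_mul]⟩
  · rintro _ ⟨s, hs, rfl⟩
    exact mul_mem (Subgroup.subset_closure (Or.inl ⟨s.1, hs.1, rfl⟩))
      (Subgroup.subset_closure (Or.inr ⟨s.2, hs.2, rfl⟩))

theorem hammingNorm_le_errorSupport_left {ι F : Type*} [Fintype ι] [Field F] [DecidableEq F]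
    (a b : ι → F) : hammingNorm a ≤ (errorSupport a b).card :=
  Finset.card_le_card fun i hi => by
    rw [Finset.mem_filter] at hi
    exact Finset.mem_filter.mpr ⟨hi.1, Or.inl hi.2⟩

theorem hammingNorm_le_errorSupport_right {ι F : Type*} [Fintype ι] [Field F] [DecidableEq F]
    (a b : ι → F) : hammingNorm b ≤ (errorSupport a b).card :=
  Finset.card_le_card fun i hi => by
    rw [Finset.mem_filter] at hi
    exact Finset.mem_filter.mpr ⟨hi.1, Or.inr hi.2⟩

variable [DecidableEq F]

/-- The parameters of a CSS code of two codes with the same minimum distance and with heavier dual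
words. -/
theorem isQuantumCode_isPureCode_cssCode {k₁ k₂ κ d : ℕ} (h : dualCode C₁ ≤ C₂)
    (h₁ : IsLinearCode C₁ k₁ d) (h₂ : IsLinearCode C₂ k₂ d)
    (hκ : Fintype.card ι + κ = k₁ + k₂) (hd : 0 < d)
    (hw₁ : ∀ c ∈ dualCode C₁, c ≠ 0 → d < hammingNorm c)
    (hw₂ : ∀ c ∈ dualCode C₂, c ≠ 0 → d < hammingNorm c) :
    IsQuantumCode p (cssCode p C₁ C₂) κ d ∧ IsPureCode p (cssCode p C₁ C₂) d := by
  rw [cssCode_eq_stabilizerCode_labelGroup h]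
  refine isQuantumCode_isPureCode_labelGroup _ ?_ ?_ ?_ hd ?_
  · have e₁ := finrank_add_finrank_dualCode C₁
    have e₂ := finrank_add_finrank_dualCode C₂
    rw [h₁.1] at e₁
    rw [h₂.1] at e₂
    rw [finrank_submodule_prod]
    omega
  · intro e f hs h0
    -- Commuting with all Z(b) puts e in C₂, and commuting with all X(a) puts f in C₁.
    have he : e ∈ C₂ := by
      rw [← dualCode_dualCode C₂]
      intro b hb
      have := hs (0, b) ⟨Submodule.zero_mem _, hb⟩
      simp only [Pi.zero_apply, zero_mul, zero_sub, Finset.sum_neg_distrib, neg_eq_zero] at this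
      rw [← this]
      exact Finset.sum_congr rfl fun i _ => mul_comm _ _
    have hf : f ∈ C₁ := by
      rw [← dualCode_dualCode C₁]
      intro a ha
      have := hs (a, 0) ⟨ha, Submodule.zero_mem _⟩
      simp only [Pi.zero_apply, zero_mul, sub_zero] at this
      rw [← this]
      exact Finset.sum_congr rfl fun i _ => mul_comm _ _
    by_cases he0 : e = 0
    · have hf0 : f ≠ 0 := by
        intro hf0
        have := errorSupport_card_eq_zero.mpr ⟨he0, hf0⟩
        omega
      exact (h₁.2.2 ⟨f, hf, hf0, rfl⟩).trans (hammingNorm_le_errorSupport_right e f)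
    · exact (h₂.2.2 ⟨e, he, he0, rfl⟩).trans (hammingNorm_le_errorSupport_left e f)
  · obtain ⟨c, hc, -, hw⟩ := h₂.2.1
    refine ⟨c, 0, fun s hs => ?_, ?_⟩
    · have := hs.2 c hc
      simp [this]
    · rw [← hw]
      simp [errorSupport, hammingNorm]
  · rintro ⟨a, b⟩ hs hne
    by_cases ha : a = 0
    · have hb : b ≠ 0 := by
        rintro rfl
        exact hne (by rw [ha]; rfl)
      exact (hw₂ b hs.2 hb).trans_le (hammingNorm_le_errorSupport_right a b)
    · exact (hw₁ a hs.1 ha).trans_le (hammingNorm_le_errorSupport_left a b)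

theorem hasQuantumLocality_cssCode {r : ℕ} (h : dualCode C₁ ≤ C₂)
    (hloc : ∀ i, ∃ a ∈ dualCode C₁, ∃ b ∈ dualCode C₂,
      (errorSupport a b).card ≤ r + 1 ∧ a i = 1 ∧ b i = 1) :
    HasQuantumLocality p (cssCode p C₁ C₂) r := by
  rw [cssCode_eq_stabilizerCode_labelGroup h]
  refine hasQuantumLocality_labelGroup _ fun i => ?_
  obtain ⟨a, ha, b, hb, hcard, hai, hbi⟩ := hloc i
  refine ⟨(a, 0), ⟨ha, Submodule.zero_mem _⟩, (0, b), ⟨Submodule.zero_mem _, hb⟩, ?_, hai, rfl,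
    rfl, hbi⟩
  convert hcard using 2
  ext j
  simp [errorSupport]

end CSS

/-! ### Stabilizer codes from codes over a quadratic extension -/

section QuadraticExtension

variable {F K : Type*} [Field F] [Field K] [Algebra F K]

/-- Coordinates of words over a quadratic extension as labels of error operators. -/
def labelMap {ι α : Type*} (e : ι ≃ α) (φ : K ≃ₗ[F] F × F) (w : α → F) :
    (α → K) →ₗ[F] (ι → F) × (ι → F) where
  toFun x := (fun i => (φ (x (e i))).1, fun i => w (e i) * (φ (x (e i))).2)
  map_add' x y := by
    ext i <;> simp [mul_add]
  map_smul' t x := by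
    ext i <;> simp [mul_left_comm]

/-- For fixed y the right side is a functional of x, represented by a unique element of K because
the trace form is nondegenerate. The scalar μ absorbs the weight by which `labelMap` twists the
second coordinate. -/
theorem exists_linearEquiv_trace_mul_eq [FiniteDimensional F K] [Algebra.IsSeparable F K]
    (φ : K ≃ₗ[F] F × F) {μ : F} (hμ : μ ≠ 0) : ∃ θ : (F × F) ≃ₗ[F] K, ∀ (x : K) (y : F × F),
      Algebra.trace F K (x * θ y) = (φ x).1 * y.2 - μ * (φ x).2 * y.1 := by
  let D := LinearMap.BilinForm.toDual (Algebra.traceForm F K) (traceForm_nondegenerate F K)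
  let L : (F × F) →ₗ[F] Module.Dual F K :=
    (LinearMap.snd F F F).smulRight (LinearMap.fst F F F ∘ₗ φ.toLinearMap) -
      (μ • LinearMap.fst F F F).smulRight (LinearMap.snd F F F ∘ₗ φ.toLinearMap)
  have hL : ∀ y x, L y x = y.2 * (φ x).1 - μ * y.1 * (φ x).2 := fun y x => by simp [L]
  have hinj : Function.Injective (D.symm.toLinearMap ∘ₗ L) := by
    rw [LinearMap.coe_comp]
    refine D.symm.injective.comp ?_
    rw [injective_iff_map_eq_zero]
    intro y hy
    have h1 := hL y (φ.symm (1, 0))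
    have h2 := hL y (φ.symm (0, 1))
    rw [hy] at h1 h2
    simp only [LinearMap.zero_apply, LinearEquiv.apply_symm_apply, mul_one, mul_zero, sub_zero,
      zero_sub] at h1 h2
    refine Prod.ext ?_ h1.symm
    have := neg_eq_zero.mp h2.symm
    exact (mul_eq_zero.mp this).resolve_left hμ
  refine ⟨LinearMap.linearEquivOfInjective _ hinj φ.symm.finrank_eq, fun x y => ?_⟩
  rw [LinearMap.linearEquivOfInjective_apply, mul_comm x]
  have h : Algebra.trace F K (D.symm (L y) * x) = L y x := by
    exact LinearMap.BilinForm.apply_toDual_symm_apply (hB := traceForm_nondegenerate F K) (L y) x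
  rw [LinearMap.comp_apply]
  refine h.trans ?_
  rw [hL]
  ring

section LabelMap

variable {ι α : Type*} [Fintype ι] [Fintype α] [DecidableEq F] [DecidableEq K] (e : ι ≃ α)
  (φ : K ≃ₗ[F] F × F) {w : α → F}

theorem card_errorSupport_labelMap (hw : ∀ i, w i ≠ 0) (x : α → K) :
    (errorSupport (labelMap e φ w x).1 (labelMap e φ w x).2).card = hammingNorm x := by
  refine Finset.card_equiv e fun i => ?_
  have h : x (e i) = 0 ↔ (φ (x (e i))).1 = 0 ∧ (φ (x (e i))).2 = 0 := by
    rw [← Prod.mk_eq_zero, Prod.mk.eta, LinearEquiv.map_eq_zero_iff]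
  simp only [errorSupport, labelMap, LinearMap.coe_mk, AddHom.coe_mk, Finset.mem_filter,
    Finset.mem_univ, true_and, ne_eq, mul_eq_zero, hw, false_or, h]
  tauto

theorem labelMap_injective (hw : ∀ i, w i ≠ 0) : Function.Injective (labelMap e φ w) := by
  classical
  rw [injective_iff_map_eq_zero]
  intro x hx
  have h := card_errorSupport_labelMap e φ hw x
  rw [hx, Prod.fst_zero, Prod.snd_zero, errorSupport_card_eq_zero.mpr ⟨rfl, rfl⟩] at h
  exact hammingNorm_eq_zero.mp h.symm

/-- The symplectic dual of a space of labels, in terms of the Euclidean dual over the extension. -/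
theorem exists_equiv_symplectic_iff_mem_dualCode [FiniteDimensional F K] [Algebra.IsSeparable F K]
    (hw : ∀ i, w i ≠ 0) (R : Submodule K (α → K)) :
    ∃ Θ : (ι → F) × (ι → F) ≃ (α → K), ∀ y,
      ((∀ s ∈ (R.restrictScalars F).map (labelMap e φ w),
        ∑ i, (s.1 i * y.2 i - s.2 i * y.1 i) = 0) ↔ Θ y ∈ dualCode R) ∧
      (errorSupport y.1 y.2).card = hammingNorm (Θ y) := by
  choose θ hθ using fun i => exists_linearEquiv_trace_mul_eq φ (hw i)
  let Θ : (ι → F) × (ι → F) ≃ (α → K) :=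
    { toFun := fun y i => θ i (y.1 (e.symm i), y.2 (e.symm i))
      invFun := fun x => (fun i => ((θ (e i)).symm (x (e i))).1,
        fun i => ((θ (e i)).symm (x (e i))).2)
      left_inv := fun y => by ext i <;> simp
      right_inv := fun x => by ext i; simp }
  have hΘ : ∀ y i, Θ y i = θ i (y.1 (e.symm i), y.2 (e.symm i)) := fun _ _ => rfl
  refine ⟨Θ, fun y => ⟨?_, ?_⟩⟩
  · have hform : ∀ x : α → K, ∑ i, ((labelMap e φ w x).1 i * y.2 i -
        (labelMap e φ w x).2 i * y.1 i) = Algebra.trace F K (∑ i, x i * Θ y i) := by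
      intro x
      rw [map_sum]
      refine Fintype.sum_equiv e _ _ fun i => ?_
      rw [hΘ, hθ, Equiv.symm_apply_apply]
      rfl
    constructor
    · intro h x hx
      have hsum : ∑ i, Θ y i * x i = ∑ i, x i * Θ y i :=
        Finset.sum_congr rfl fun i _ => mul_comm _ _
      rw [hsum]
      -- As R is closed under multiplication by K, the trace vanishes on every K-multiple of the
      -- pairing, hence the pairing itself is 0.
      refine (traceForm_nondegenerate F K).2 _ fun c => ?_
      rw [Algebra.traceForm_apply, Finset.mul_sum, ← h _ ⟨c • x, R.smul_mem c hx, rfl⟩, hform]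
      congr 1
      exact Finset.sum_congr rfl fun i _ => by simp [mul_assoc]
    · rintro h _ ⟨x, hx, rfl⟩
      rw [hform]
      have hsum : ∑ i, x i * Θ y i = ∑ i, Θ y i * x i :=
        Finset.sum_congr rfl fun i _ => mul_comm _ _
      rw [hsum, h x hx, map_zero]
  · refine Finset.card_equiv e fun i => ?_
    simp only [errorSupport, Finset.mem_filter, Finset.mem_univ, true_and, hΘ,
      Equiv.symm_apply_apply, ne_eq, LinearEquiv.map_eq_zero_iff, Prod.mk_eq_zero]
    tauto

end LabelMap

/-- Apply ℓ to the coefficients: powers of t lie in F and pass through ℓ. -/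
theorem exists_polynomial_eval_eq_apply_eval (ℓ : K →ₗ[F] F) (Q : Polynomial K) :
    ∃ P : Polynomial F, P.natDegree ≤ Q.natDegree ∧
      ∀ t : F, P.eval t = ℓ (Q.eval (algebraMap F K t)) := by
  refine ⟨∑ l ∈ Finset.range (Q.natDegree + 1), Polynomial.monomial l (ℓ (Q.coeff l)), ?_,
    fun t => ?_⟩
  · refine Polynomial.natDegree_sum_le_of_forall_le _ _ fun l hl => ?_
    exact (Polynomial.natDegree_monomial_le _).trans (by rw [Finset.mem_range] at hl; omega)
  · rw [Polynomial.eval_eq_sum_range (p := Q), map_sum, Polynomial.eval_finsetSum]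
    refine Finset.sum_congr rfl fun l _ => ?_
    rw [Polynomial.eval_monomial, ← map_pow, mul_comm (Q.coeff l), ← Algebra.smul_def, map_smul,
      smul_eq_mul, mul_comm]

theorem card_filter_equiv_fst_eq {ι : Type*} [Fintype ι] {u m : ℕ} (e : ι ≃ Fin u × Fin m)
    (g : Fin u) : (Finset.univ.filter fun i => (e i).1 = g).card = m := by
  refine (Finset.card_equiv e fun i => ?_).trans (card_filter_fst_eq g)
  simp

/-- Label spaces from the row space of a block parity-check matrix over a quadratic extension, with
evaluation points in translates of the small field. -/
theorem exists_isQuantumCode_of_translates (p : ℕ) [Fact p.Prime] {ι : Type*} [Fintype ι]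
    [DecidableEq ι] [Fintype F] [DecidableEq F] [Algebra (ZMod p) F] [FiniteDimensional F K]
    [Algebra.IsSeparable F K] (φ : K ≃ₗ[F] F × F) {d r u κ : ℕ} (e : ι ≃ Fin u × Fin (r + 1))
    (hu : 0 < u) (hd : 2 ≤ d) (hr : 2 * (d - 2) + u < r)
    (hκ : u * r = κ + 2 * (d - 2) + u) {t : Fin (r + 1) → F} (ht : Function.Injective t)
    {β : Fin u → K} (hβ : ∀ g g' x, β g - β g' = algebraMap F K x → g = g') :
    ∃ Q : Submodule ℂ (QuditSpace ι F),
      IsQuantumCode p Q κ d ∧ IsPureCode p Q d ∧ HasQuantumLocality p Q r := by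
  classical
  set a : Fin u → Fin (r + 1) → K := fun g j => β g + algebraMap F K (t j) with ha_def
  set v : Fin u → Fin (r + 1) → K := fun _ _ => 1 with hv_def
  -- All blocks share these weights, since translating the points by β does not affect the
  -- polynomials in t over F used below.
  set w : Fin u × Fin (r + 1) → F := fun x => Lagrange.nodalWeight Finset.univ t x.2
  have hw : ∀ x, w x ≠ 0 := fun x =>
    Lagrange.nodalWeight_ne_zero ht.injOn (Finset.mem_univ x.2)
  have hv : ∀ g j, v g j ≠ 0 := fun _ _ => one_ne_zero
  have ha : ∀ g, Function.Injective (a g) := fun g j j' h =>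
    ht ((algebraMap F K).injective (add_left_cancel h))
  have hU : ∀ S : Finset (Fin u), S.Nonempty → S.card ≤ (d - 1) / 2 →
      r * S.card + 1 ≤ (S.biUnion fun g => Finset.univ.image (a g)).card := by
    intro S hS _
    rw [Finset.card_biUnion]
    · simp only [Finset.card_image_of_injective _ (ha _), Finset.card_univ, Fintype.card_fin,
        Finset.sum_const, smul_eq_mul]
      have := hS.card_pos
      rw [mul_add, mul_one, mul_comm r]
      omega
    · intro g _ g' _ hgg'
      rw [Function.onFun, Finset.disjoint_left]
      intro z hz hz'
      obtain ⟨j, -, rfl⟩ := Finset.mem_image.mp hz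
      obtain ⟨j', -, h⟩ := Finset.mem_image.mp hz'
      refine hgg' (hβ g g' (t j' - t j) ?_)
      simp only [ha_def] at h
      rw [map_sub]
      linear_combination -h
  set R := blockRowSpace d a v with hR
  set S := (R.restrictScalars F).map (labelMap e φ w)
  have hS : ∀ s ∈ S, ∀ s' ∈ S, ∑ i, s.2 i * s'.1 i = 0 := by
    rintro _ ⟨_, ⟨y, rfl⟩, rfl⟩ _ ⟨_, ⟨y', rfl⟩, rfl⟩
    -- On a block, each F-coordinate of a row word is a polynomial over F in t of degree at most d -
    -- 2, so products of two coordinates are killed by the nodal weights of t.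
    have hpoly : ∀ (ℓ : K →ₗ[F] F) (y : Fin u ⊕ Fin (d - 2) → K) (g : Fin u), ∃ P : Polynomial F,
        P.natDegree ≤ d - 2 ∧ ∀ j, P.eval (t j) =
          ℓ ((blockParityCheck d a v).vecMulLinear y (g, j)) := by
      intro ℓ y g
      obtain ⟨P, hP, hPe⟩ := exists_polynomial_eval_eq_apply_eval ℓ
        ((blockPoly y g).comp (Polynomial.X + Polynomial.C (β g)))
      refine ⟨P, hP.trans ?_, fun j => ?_⟩
      · rw [Polynomial.natDegree_comp, Polynomial.natDegree_X_add_C, mul_one]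
        exact natDegree_blockPoly_le y g
      · rw [hPe, vecMul_blockParityCheck]
        simp only [hv_def, ha_def, one_mul, Polynomial.eval_comp, Polynomial.eval_add,
          Polynomial.eval_X, Polynomial.eval_C, add_comm]
    refine (Fintype.sum_equiv e _ (fun x => w x *
      (φ ((blockParityCheck d a v).vecMulLinear y x)).2 *
      (φ ((blockParityCheck d a v).vecMulLinear y' x)).1) fun i => rfl).trans ?_
    rw [Fintype.sum_prod_type]
    refine Finset.sum_eq_zero fun g _ => ?_
    obtain ⟨P, hP, hPe⟩ := hpoly (LinearMap.snd F F F ∘ₗ φ.toLinearMap) y g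
    obtain ⟨P', hP', hPe'⟩ := hpoly (LinearMap.fst F F F ∘ₗ φ.toLinearMap) y' g
    have hdeg : (P * P').natDegree + 1 < (Finset.univ : Finset (Fin (r + 1))).card := by
      rw [Finset.card_univ, Fintype.card_fin]
      have := Polynomial.natDegree_mul_le (p := P) (q := P')
      omega
    rw [← sum_nodalWeight_mul_eval_eq_zero (a := t) ht.injOn hdeg]
    refine Finset.sum_congr rfl fun j _ => ?_
    rw [Polynomial.eval_mul, hPe, hPe', ← mul_assoc]
    rfl
  obtain ⟨Θ, hΘ⟩ := exists_equiv_symplectic_iff_mem_dualCode e φ hw R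
  rw [dualCode_blockRowSpace] at hΘ
  have hcode := isQuantumCode_isPureCode_labelGroup (p := p) (κ := κ) (d := d) hS ?_ ?_ ?_
    (by omega) ?_
  · refine ⟨_, hcode.1, hcode.2, hasQuantumLocality_labelGroup hS fun i => ?_⟩
    -- K-multiples of one local row give a pure X label and a pure Z label on the same block; the
    -- inverse weight cancels the twist at position i.
    refine ⟨_, ⟨_, localRow_mem_blockRowSpace a v (e i).1 (φ.symm (1, 0)), rfl⟩,
      _, ⟨_, localRow_mem_blockRowSpace a v (e i).1 (φ.symm (0, (w (e i))⁻¹)), rfl⟩,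
      ?_, ?_, ?_, ?_, ?_⟩
    · refine le_of_le_of_eq (Finset.card_le_card fun j hj => ?_)
        (card_filter_equiv_fst_eq e (e i).1)
      rw [Finset.mem_filter]
      refine ⟨Finset.mem_univ _, ?_⟩
      by_contra h
      simp [errorSupport, labelMap, h] at hj
    · simp [labelMap, hv_def]
    · simp [labelMap, hv_def]
    · simp [labelMap, hv_def]
    · simp [labelMap, hv_def, hw]
  · have h1 : Module.finrank F S = Module.finrank F R :=
      (Submodule.equivMapOfInjective _ (labelMap_injective e φ hw) _).finrank_eq.symm
    have h2 : Module.finrank F K = 2 := by rw [φ.finrank_eq]; simp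
    have h3 := Module.finrank_mul_finrank F K R
    rw [h2, hR, finrank_blockRowSpace hu ha hv (by omega)] at h3
    rw [h1, hR, ← h3, Fintype.card_congr e, Fintype.card_prod, Fintype.card_fin, Fintype.card_fin,
      mul_add u, hκ]
    ring
  · intro x y h h0
    obtain ⟨h1, h2⟩ := hΘ (x, y)
    simp only at h2
    rw [h2] at h0 ⊢
    refine le_hammingNorm_of_mem_blockCode hd hv hU (h1.mp h) ?_
    intro h'
    rw [h', hammingNorm_zero] at h0
    exact lt_irrefl 0 h0
  · obtain ⟨c, hc, hcw⟩ := exists_mem_blockCode_hammingNorm_eq (d := d) hu hd (by omega) ha hv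
    obtain ⟨h1, h2⟩ := hΘ (Θ.symm c)
    rw [Equiv.apply_symm_apply] at h1 h2
    exact ⟨_, _, h1.mpr hc, h2.trans hcw⟩
  · rintro _ ⟨_, ⟨y, rfl⟩, rfl⟩ hne
    rw [card_errorSupport_labelMap e φ hw]
    have hy : y ≠ 0 := by
      rintro rfl
      exact hne (by simp)
    have := le_hammingNorm_blockRowSpace hu ha hv hy
    omega

end QuadraticExtension

/-! ### Numerical parameters -/

section Parameters

theorem ceil_div_eq {x r u : ℤ} (hr : 0 < r) (h₁ : (u - 1) * r < x) (h₂ : x ≤ u * r) :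
    ⌈(x : ℚ) / r⌉ = u := by
  have hr' : (0 : ℚ) < r := by exact_mod_cast hr
  rw [Int.ceil_eq_iff, lt_div_iff₀ hr', div_le_iff₀ hr']
  exact ⟨by exact_mod_cast h₁, by exact_mod_cast h₂⟩

theorem floor_div_eq {x r u : ℤ} (hr : 0 < r) (h₁ : u * r ≤ x) (h₂ : x < (u + 1) * r) :
    ⌊(x : ℚ) / r⌋ = u := by
  have hr' : (0 : ℚ) < r := by exact_mod_cast hr
  rw [Int.floor_eq_iff, le_div_iff₀ hr', div_lt_iff₀ hr']
  exact ⟨by exact_mod_cast h₁, by exact_mod_cast h₂⟩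

variable {d r u κ : ℤ}

theorem meetsSingletonLRC_of_lt (hd : 2 ≤ d) (hdr : d - 2 < r) :
    MeetsSingletonLRC (u * (r + 1)) (u * r - d + 2) d r := by
  have h : ⌈((u * r - d + 2 : ℤ) : ℚ) / r⌉ = u :=
    ceil_div_eq (by omega) (by linarith) (by linarith)
  rw [MeetsSingletonLRC, h]
  ring

/-- κ falls short of u r by 2(d - 2) + u, which lies in [0, r), so the ceiling is u. -/
theorem meetsQuantumSingleton_of_lt (hd : 2 ≤ d) (hu : 0 ≤ u) (hr : 2 * (d - 2) + u < r)
    (hκ : κ = u * r - 2 * (d - 2) - u) : MeetsQuantumSingleton (u * (r + 1)) κ d r := by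
  have h : ⌈(κ : ℚ) / r⌉ = u := ceil_div_eq (by omega) (by linarith) (by linarith)
  rw [MeetsQuantumSingleton, h, hκ]
  ring

theorem meetsQuantumSingletonDim_of_lt (hd : 2 ≤ d) (hu : 0 ≤ u) (hr : 2 * (d - 2) + u < r)
    (hκ : κ = u * r - 2 * (d - 2) - u) : MeetsQuantumSingletonDim (u * (r + 1)) κ d r := by
  -- Both numerators are u(r + 1) minus an amount in [1, r + 1], namely d - 1 and 2(d - 2) + u + 1,
  -- so both floors are u - 1.
  have h₁ : ⌊((u * (r + 1) - (d - 1) : ℤ) : ℚ) / (r + 1)⌋ = u - 1 := by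
    have := floor_div_eq (x := u * (r + 1) - (d - 1)) (r := r + 1) (u := u - 1) (by omega)
      (by linarith) (by linarith)
    exact_mod_cast this
  have h₂ : ⌊((u * (r + 1) - 2 * (d - 1) - (u - 1) : ℤ) : ℚ) / (r + 1)⌋ = u - 1 := by
    have := floor_div_eq (x := u * (r + 1) - 2 * (d - 1) - (u - 1)) (r := r + 1) (u := u - 1)
      (by omega) (by linarith) (by linarith)
    exact_mod_cast this
  rw [MeetsQuantumSingletonDim, h₁, h₂, hκ]
  ring

end Parameters

/-! ### The quantum codes -/

section BlockCodeDuality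

variable {F : Type*} [Field F] {d r u : ℕ}

/-- The orthogonality holds block by block, because v v' are nodal weights and the product
polynomial has degree at most 2(d - 2) < r. -/
theorem blockRowSpace_le_blockCode {a v v' : Fin u → Fin (r + 1) → F}
    (ha : ∀ i, Function.Injective (a i)) (hr : 2 * (d - 2) < r)
    (hv : ∀ i j, v i j * v' i j = Lagrange.nodalWeight Finset.univ (a i) j) :
    blockRowSpace d a v ≤ blockCode d a v' := by
  rw [← dualCode_blockRowSpace]
  rintro _ ⟨y, rfl⟩ _ ⟨y', rfl⟩
  rw [Fintype.sum_prod_type]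
  refine Finset.sum_eq_zero fun g _ => ?_
  have hdeg : (blockPoly y g * blockPoly y' g).natDegree + 1 <
      (Finset.univ : Finset (Fin (r + 1))).card := by
    rw [Finset.card_univ, Fintype.card_fin]
    have := Polynomial.natDegree_mul_le (p := blockPoly y g) (q := blockPoly y' g)
    have := natDegree_blockPoly_le y g
    have := natDegree_blockPoly_le y' g
    omega
  rw [← sum_nodalWeight_mul_eval_eq_zero (a := a g) (ha g).injOn hdeg]
  refine Finset.sum_congr rfl fun j _ => ?_
  rw [vecMul_blockParityCheck, vecMul_blockParityCheck, ← hv, Polynomial.eval_mul]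
  ring

theorem lt_hammingNorm_of_mem_dualCode_blockCode [DecidableEq F] (hu : 0 < u) (hd : 2 ≤ d)
    (hr : 2 * (d - 2) + u < r) {a v : Fin u → Fin (r + 1) → F}
    (ha : ∀ i, Function.Injective (a i)) (hv : ∀ i j, v i j ≠ 0) {c : Fin u × Fin (r + 1) → F}
    (hc : c ∈ dualCode (blockCode d a v)) (hc0 : c ≠ 0) : d < hammingNorm c := by
  rw [dualCode_blockCode] at hc
  obtain ⟨y, rfl⟩ := hc
  have hy : y ≠ 0 := by
    rintro rfl
    exact hc0 (map_zero _)
  have := le_hammingNorm_blockRowSpace hu ha hv hy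
  omega

end BlockCodeDuality

section QuantumBlockCodes

variable (p : ℕ) [Fact p.Prime] {F : Type*} [Field F] [Fintype F] [DecidableEq F]
  [Algebra (ZMod p) F] {d r u κ : ℕ}

theorem exists_isQuantumCode_locality (hd : 2 ≤ d) (hu : 0 < u) (hrq : r ≤ Fintype.card F - 1)
    (hr : 2 * (d - 2) + u < r) (hκ : u * r = κ + 2 * (d - 2) + u) :
    ∃ Q : Submodule ℂ (QuditSpace (Fin (u * (r + 1))) F),
      IsQuantumCode p Q κ d ∧ IsPureCode p Q d ∧ HasQuantumLocality p Q r := by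
  have : CharP F p := charP_of_injective_algebraMap (algebraMap (ZMod p) F).injective p
  have hq := Fintype.card_pos (α := F)
  have h2 : Module.finrank F (FiniteField.Extension F p 2) = 2 :=
    FiniteField.finrank_extension F p 2
  let φ : FiniteField.Extension F p 2 ≃ₗ[F] F × F :=
    LinearEquiv.ofFinrankEq _ _ (by rw [h2]; simp)
  obtain ⟨t⟩ : Nonempty (Fin (r + 1) ↪ F) :=
    Function.Embedding.nonempty_of_card_le (by rw [Fintype.card_fin]; omega)
  obtain ⟨b⟩ : Nonempty (Fin u ↪ F) :=
    Function.Embedding.nonempty_of_card_le (by rw [Fintype.card_fin]; omega)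
  -- For γ outside F, the multiples γ b with distinct b in F lie in distinct cosets of F. There are
  -- enough of them, as u < r < q.
  obtain ⟨γ, hγ⟩ : ∃ γ : FiniteField.Extension F p 2, ∀ x, algebraMap F _ x ≠ γ := by
    by_contra! h
    have : Module.finrank F (FiniteField.Extension F p 2) ≤ 1 :=
      finrank_le_one 1 fun γ => by
        obtain ⟨x, hx⟩ := h γ
        exact ⟨x, by rw [← hx, Algebra.algebraMap_eq_smul_one]⟩
    omega
  refine exists_isQuantumCode_of_translates (K := FiniteField.Extension F p 2) p φ
    finProdFinEquiv.symm hu hd hr hκ t.injective (β := fun g => γ * algebraMap F _ (b g)) ?_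
  intro g g' x h
  by_contra hgg'
  have hb : b g - b g' ≠ 0 := sub_ne_zero.mpr fun h => hgg' (b.injective h)
  refine hγ (x / (b g - b g')) ?_
  rw [map_div₀, div_eq_iff ((map_ne_zero (algebraMap F _)).mpr hb), ← h, map_sub]
  ring

theorem hasQuantumLocality_cssCode_blockCode {a v v' : Fin u → Fin (r + 1) → F}
    (hv : ∀ i j, v i j ≠ 0) (hv' : ∀ i j, v' i j ≠ 0)
    (h : dualCode (blockCode d a v) ≤ blockCode d a v') :
    HasQuantumLocality p (cssCode p (blockCode d a v) (blockCode d a v')) r := by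
  refine hasQuantumLocality_cssCode h fun i => ?_
  refine ⟨_, by rw [dualCode_blockCode]; exact localRow_mem_blockRowSpace a v i.1 (v i.1 i.2)⁻¹,
    _, by rw [dualCode_blockCode]; exact localRow_mem_blockRowSpace a v' i.1 (v' i.1 i.2)⁻¹,
    ?_, ?_, ?_⟩
  · refine le_of_le_of_eq (Finset.card_le_card fun x hx => ?_) (card_filter_fst_eq i.1)
    rw [Finset.mem_filter]
    refine ⟨Finset.mem_univ _, ?_⟩
    by_contra h
    simp [errorSupport, h] at hx
  · simp [hv]
  · simp [hv']

end QuantumBlockCodes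

/-! ### The two constructions combined -/

theorem theorem4p2 (p : ℕ) [Fact p.Prime] (F : Type*) [Field F] [Fintype F] [DecidableEq F]
    [Algebra (ZMod p) F] (d r u : ℕ) (hd : 2 ≤ d) (hr0 : 1 ≤ r) (hu0 : 1 ≤ u)
    (hrq : r ≤ Fintype.card F - 1) (hr : 2 * (d - 2) + u < r) :
    ∃ κ : ℕ, (κ : ℤ) = (u : ℤ) * r - 2 * ((d : ℤ) - 2) - u ∧
      -- the parameters attain both bounds
      MeetsQuantumSingleton ((u : ℤ) * (r + 1)) κ d r ∧
      MeetsQuantumSingletonDim ((u : ℤ) * (r + 1)) κ d r ∧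
      -- existence of the quantum code
      (∃ Q : Submodule ℂ (QuditSpace (Fin (u * (r + 1))) F),
        IsQuantumCode p Q κ d ∧ IsPureCode p Q d ∧ HasQuantumLocality p Q r) ∧
      -- the code obtained from the classical block codes, whenever these have distance `d`
      (∀ a v : Fin u → Fin (r + 1) → F,
        (∀ i, Function.Injective (a i)) → (∀ i j, v i j ≠ 0) →
        (5 ≤ d → ∀ S : Finset (Fin u), S.Nonempty → S.card ≤ (d - 1) / 2 →
          r * S.card + 1 ≤ (S.biUnion fun g => Finset.univ.image (a g)).card) →
        ∃ v' : Fin u → Fin (r + 1) → F, (∀ i j, v' i j ≠ 0) ∧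
          (∀ i, dualCode (grsCode (d - 1) (a i) (v i)) = grsCode (r + 2 - d) (a i) (v' i)) ∧
          (∀ C ∈ ({blockCode d a v, blockCode d a v'} :
              Set (Submodule F (Fin u × Fin (r + 1) → F))),
            IsLinearCode C (u * r + 2 - d) d ∧ HasLocality C r ∧
            MeetsSingletonLRC ((u : ℤ) * (r + 1)) ((u : ℤ) * r - d + 2) d r) ∧
          dualCode (blockCode d a v) < blockCode d a v' ∧
          IsQuantumCode p (cssCode p (blockCode d a v) (blockCode d a v')) κ d ∧
          IsPureCode p (cssCode p (blockCode d a v) (blockCode d a v')) d ∧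
          HasQuantumLocality p (cssCode p (blockCode d a v) (blockCode d a v')) r) := by
  obtain ⟨κ, hκ⟩ : ∃ κ, u * r = κ + 2 * (d - 2) + u :=
    ⟨u * r - 2 * (d - 2) - u, by have := Nat.le_mul_of_pos_left r hu0; omega⟩
  have hd' : (2 : ℤ) ≤ d := by exact_mod_cast hd
  have hr' : 2 * ((d : ℤ) - 2) + u < r := by omega
  have hκ' : (κ : ℤ) = (u : ℤ) * r - 2 * ((d : ℤ) - 2) - u := by
    have : ((u * r : ℕ) : ℤ) = κ + 2 * ((d : ℤ) - 2) + u := by rw [hκ]; omega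
    rw [Nat.cast_mul] at this
    linarith
  refine ⟨κ, hκ', meetsQuantumSingleton_of_lt hd' (by omega) hr' hκ',
    meetsQuantumSingletonDim_of_lt hd' (by omega) hr' hκ',
    exists_isQuantumCode_locality p hd hu0 hrq hr hκ, fun a v ha hv hU => ?_⟩
  have hU' : ∀ S : Finset (Fin u), S.Nonempty → S.card ≤ (d - 1) / 2 →
      r * S.card + 1 ≤ (S.biUnion fun g => Finset.univ.image (a g)).card := by
    intro S hS hScard
    by_cases h5 : 5 ≤ d
    · exact hU h5 S hS hScard
    -- For d ≤ 4 the bound (d - 1) / 2 is at most 1, and a single block has r + 1 distinct points.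
    · have := hS.card_pos
      obtain ⟨g, rfl⟩ := Finset.card_eq_one.mp (show S.card = 1 by omega)
      rw [Finset.singleton_biUnion, Finset.card_image_of_injective _ (ha g)]
      simp
  set v' : Fin u → Fin (r + 1) → F := fun i j =>
    (v i j)⁻¹ * Lagrange.nodalWeight Finset.univ (a i) j with hv'_def
  have hv' : ∀ i j, v' i j ≠ 0 := fun i j => mul_ne_zero (inv_ne_zero (hv i j))
    (Lagrange.nodalWeight_ne_zero (ha i).injOn (Finset.mem_univ j))
  have hlin : ∀ w : Fin u → Fin (r + 1) → F, (∀ i j, w i j ≠ 0) →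
      IsLinearCode (blockCode d a w) (u * r + 2 - d) d := fun w hw =>
    isLinearCode_blockCode hu0 hd (by omega) ha hw hU'
  have hle : dualCode (blockCode d a v) ≤ blockCode d a v' := by
    rw [dualCode_blockCode]
    exact blockRowSpace_le_blockCode ha (by omega) fun i j =>
      mul_inv_cancel_left₀ (hv i j) _
  have hcss := isQuantumCode_isPureCode_cssCode (p := p) (κ := κ) hle (hlin v hv) (hlin v' hv')
    (by rw [Fintype.card_prod, Fintype.card_fin, Fintype.card_fin, mul_add, mul_one]; omega)
    (by omega)
    (fun c => lt_hammingNorm_of_mem_dualCode_blockCode hu0 hd hr ha hv)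
    (fun c => lt_hammingNorm_of_mem_dualCode_blockCode hu0 hd hr ha hv')
  refine ⟨v', hv', fun i => ?_, ?_, lt_of_le_of_ne hle fun h => ?_, hcss.1, hcss.2,
    hasQuantumLocality_cssCode_blockCode p hv hv' hle⟩
  · rw [dualCode_grsCode (ha i) (hv i) (by omega), show r + 1 - (d - 1) = r + 2 - d by omega]
  · have hmem : ∀ w : Fin u → Fin (r + 1) → F, (∀ i j, w i j ≠ 0) →
        IsLinearCode (blockCode d a w) (u * r + 2 - d) d ∧ HasLocality (blockCode d a w) r ∧
        MeetsSingletonLRC ((u : ℤ) * (r + 1)) ((u : ℤ) * r - d + 2) d r := fun w hw =>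
      ⟨hlin w hw, hasLocality_blockCode hw, meetsSingletonLRC_of_lt hd' (by omega)⟩
    rintro C (rfl | rfl)
    · exact hmem v hv
    · exact hmem v' hv'
  -- Equality of the codes would force u r = 2(d - 2) + u by dimension, which is less than r ≤ u r.
  · have h1 := (hlin v' hv').1
    rw [← h, dualCode_blockCode, finrank_blockRowSpace hu0 ha hv (by omega)] at h1
    have := Nat.le_mul_of_pos_left r hu0
    omega
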